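/- **Conventions.** For posets, $q\le p$ means that $q$ is the stronger condition. $H_\theta$ is the set of all sets whose transitive closure has size less than $\theta$, and $M\prec H_\theta$ means that $(M,\in)$ is an elementary submodel of $(H_\theta,\in)$. $RO(P)$ denotes the completion of the poset $P$ (the complete Boolean algebra of regular open subsets of $P$, where open means closed downward), and for $s\in RO(P)$ and $r\in P$ the relation $s\ge r$ refers to the canonical map $P\to RO(P)$. Filters on $RO(P)$ are proper. **Y-properness.** A condition $q\in P$ is *master* for $M$ if for every dense set $D\subseteq P$ with $D\in M$, the set $D\cap M$ is predense below $q$. A poset $P$ is *Y-proper* if for all sufficiently large regular cardinals $\theta$, for every countable $M\prec H_\theta$ with $P\in M$ and every $p\in P\cap M$ there is $q\le p$ which is master for $M$ and such that for every $r\le q$ there is a filter $F\in M$ on $RO(P)$ with $\{s\in RO(P)\cap M: s\ge r\}\subseteq F$. **Ideal based triples.** An *ideal based triple* is a triple $\langle U,\prec,I\rangle$ such that 1. $U$ is a collection of finite subsets of $\omega_1$ and $\prec$ is a (reflexive) partial ordering on $U$ refining inclusion: $a\prec b$ implies $a\subseteq b$; 2. if $a\in U$ and $\beta\in\omega_1$,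 then $a\cap\beta\in U$ and $a\cap\beta\prec a$; 3. $I$ is an ideal on $\omega_1$ containing all singletons; 4. every $I$-positive set (subset of $\omega_1$ not in $I$) has a countable $I$-positive subset; 5. for every $a\in U$ the set $\{\beta\in\omega_1: a\prec a\cup\{\beta\}\}$ is not covered by countably many elements of $I$; 6. for every $a\in U$ the set $\{\beta\in\omega_1: a\cap\beta\prec(a\cap\beta)\cup\{\beta\}$ and $a\not\prec a\cup\{\beta\}\}$ is in $I$. Here $a \prec b$ includes that $a,b\in U$. **Ideal based forcings.** Let $\langle U,\prec,I\rangle$ be an ideal based triple and let $\lambda$ be a regular cardinal with $I\in H_\lambda$. The associated *ideal based forcing* $P$ consists of all finite sets $p$ of ordered pairs $\langle M,\alpha\rangle$, where $M\prec H_\lambda$ is countable and $\alpha\in\omega_1\setminus\bigcup(I\cap M)$, such that $w(p)=\{\alpha:\exists M\ \langle M,\alpha\rangle\in p\}\in U$, and such that for any two distinct elements $\langle M,\alpha\rangle,\langle N,\beta\rangle$ of $p$, either $M\in N$ and $\alpha\in N$, or $N\in M$ and $\beta\in M$. The ordering is: $q\le p$ if $p\subseteq q$ and $w(p)\prec w(q)$.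 **Theorem.** Every ideal based forcing is Y-proper. -/

import Mathlib

open scoped FirstOrder

universe u

namespace YForcing

/-! ### Sets of hereditary cardinality less than `θ` -/

/-- The first uncountable ordinal, as a von Neumann ordinal. -/
noncomputable def omegaOne : ZFSet.{u} := Ordinal.toZFSet (Ordinal.omega 1)

/-- The transitive closure of a set: the elements, the elements of elements, and so on. -/
noncomputable def trcl (x : ZFSet.{u}) : ZFSet.{u} :=
  ZFSet.sep (fun y => Relation.TransGen (fun a b : ZFSet.{u} => a ∈ b) y x)
    (ZFSet.vonNeumann x.rank)

theorem mem_trcl {x y : ZFSet.{u}} :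
    y ∈ trcl x ↔ Relation.TransGen (fun a b : ZFSet.{u} => a ∈ b) y x := by
  refine ⟨fun h => (ZFSet.mem_sep.1 h).2, fun h => ZFSet.mem_sep.2 ⟨?_, h⟩⟩
  rw [ZFSet.mem_vonNeumann]
  induction h with
  | single h => exact ZFSet.rank_lt_of_mem h
  | tail _ h ih => exact ih.trans (ZFSet.rank_lt_of_mem h)

/-- `H θ`, the set of all sets whose transitive closure has size less than `θ`. The bound by a level
of the cumulative hierarchy is no restriction, by `mem_H`. -/
noncomputable def H (θ : Cardinal.{u}) : ZFSet.{u} :=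
  ZFSet.sep (fun x => ZFSet.card (trcl x) < θ) (ZFSet.vonNeumann θ.ord)

theorem exists_rank_eq (x : ZFSet.{u}) :
    ∀ o < x.rank, ∃ y ∈ trcl x, y.rank = o := by
  induction x using ZFSet.inductionOn with
  | _ x ih =>
    intro o ho
    obtain ⟨y, hy, hoy⟩ := ZFSet.lt_rank_iff.1 ho
    rcases hoy.eq_or_lt with h | h
    · exact ⟨y, mem_trcl.2 (.single hy), h.symm⟩
    · obtain ⟨z, hz, hzo⟩ := ih y hy o h
      exact ⟨z, mem_trcl.2 ((mem_trcl.1 hz).tail hy), hzo⟩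

theorem mem_H {θ : Cardinal.{u}} {x : ZFSet.{u}} : x ∈ H θ ↔ ZFSet.card (trcl x) < θ := by
  refine ⟨fun h => (ZFSet.mem_sep.1 h).2, fun h => ZFSet.mem_sep.2 ⟨?_, h⟩⟩
  rw [ZFSet.mem_vonNeumann, Cardinal.lt_ord]
  refine lt_of_le_of_lt ?_ h
  rw [← Cardinal.lift_le.{u + 1}, ← ZFSet.cardinalMk_coe_sort, ← Cardinal.mk_Iio_ordinal]
  choose g hg hr using exists_rank_eq x
  exact Cardinal.mk_le_of_injective (β := {y // y ∈ trcl x})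
    (f := fun o : Set.Iio x.rank => ⟨g o.1 o.2, hg o.1 o.2⟩) fun a b h => Subtype.ext <|
      (hr a.1 a.2).symm.trans ((congrArg (fun y => y.1.rank) h).trans (hr b.1 b.2))

/-! ### Elementary submodels -/

/-- The only symbol of the language of set theory is a binary relation symbol. -/
inductive SetRel : ℕ → Type
  | mem : SetRel 2

/-- The first-order language of set theory. -/
def setLanguage : FirstOrder.Language := ⟨fun _ => Empty, SetRel⟩

/-- Every set is a structure for the language of set theory, with the true membership relation. -/
instance setStructure (x : ZFSet.{u}) : setLanguage.Structure x where
  funMap := fun f => Empty.elim f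
  RelMap := fun {_} R => match R with
    | SetRel.mem => fun v => (v 0 : ZFSet.{u}) ∈ (v 1 : ZFSet.{u})

/-- `M ≺ N`: the inclusion map is an elementary embedding of `(M, ∈)` into `(N, ∈)`. -/
def ElemSub (M N : ZFSet.{u}) : Prop :=
  ∃ f : M ↪ₑ[setLanguage] N, ∀ x : M, (f x : ZFSet.{u}) = x

/-! ### Posets, their completions, and Y-properness -/

/-- A partially ordered set inside the universe of sets: `ZFSet.pair q p ∈ rel` means `q ≤ p`,
that is, `q` is a stronger condition than `p`. -/
structure Poset where
  carrier : ZFSet.{u}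
  rel : ZFSet.{u}
  rel_subset : rel ⊆ ZFSet.prod carrier carrier
  refl : ∀ p ∈ carrier, ZFSet.pair p p ∈ rel
  trans : ∀ p q r, ZFSet.pair p q ∈ rel → ZFSet.pair q r ∈ rel → ZFSet.pair p r ∈ rel
  antisymm : ∀ p q, ZFSet.pair p q ∈ rel → ZFSet.pair q p ∈ rel → p = q

namespace Poset

variable (P : Poset.{u})

/-- The poset as a single set, the ordered pair of its underlying set and its ordering. -/
def code : ZFSet.{u} := ZFSet.pair P.carrier P.rel

/-- `q ≤ p`. -/
def Le (q p : ZFSet.{u}) : Prop := ZFSet.pair q p ∈ P.rel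

/-- Two conditions are compatible if they have a common lower bound. -/
def Compat (p q : ZFSet.{u}) : Prop := ∃ r, P.Le r p ∧ P.Le r q

/-- `D` is a dense subset of the poset. -/
def IsDense (D : ZFSet.{u}) : Prop :=
  D ⊆ P.carrier ∧ ∀ p ∈ P.carrier, ∃ d ∈ D, P.Le d p

/-- The underlying set of the completion `RO(P)`: the regular open subsets of `P`, for the topology
whose open sets are the downward closed sets. `RO(P)` is ordered by inclusion, and its zero
element is the empty set. -/
noncomputable def RO : ZFSet.{u} :=
  ZFSet.sep (fun b => ∀ p ∈ P.carrier,
    p ∈ b ↔ ∀ q, P.Le q p → ∃ r, P.Le r q ∧ r ∈ b) (ZFSet.powerset P.carrier)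

/-- The canonical map from `P` to `RO(P)`: it takes `p` to the regularization of the cone below
`p`. -/
noncomputable def toRO (p : ZFSet.{u}) : ZFSet.{u} :=
  ZFSet.sep (fun q => ∀ r, P.Le r q → P.Compat r p) P.carrier

/-- `F` is a (proper) filter on `RO(P)`. -/
structure IsFilterRO (F : ZFSet.{u}) : Prop where
  subset : F ⊆ P.RO
  nonempty : F.Nonempty
  empty_notMem : ∅ ∉ F
  mem_of_subset : ∀ b ∈ F, ∀ c ∈ P.RO, b ⊆ c → c ∈ F
  directed : ∀ b ∈ F, ∀ c ∈ F, ∃ d ∈ F, d ⊆ b ∧ d ⊆ c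

/-- `q` is a master condition for `M`: it forces the generic filter to meet `D ∩ M`, for every dense
set `D ∈ M`. That is, `D ∩ M` is predense below `q`. -/
def IsMaster (M q : ZFSet.{u}) : Prop :=
  ∀ D ∈ M, P.IsDense D → ∀ r, P.Le r q → ∃ d ∈ D, d ∈ M ∧ P.Compat d r

/-- `q` is a Y-master condition for `M`. -/
def IsYMaster (M q : ZFSet.{u}) : Prop :=
  P.IsMaster M q ∧ ∀ r, P.Le r q →
    ∃ F ∈ M, P.IsFilterRO F ∧ ∀ s ∈ P.RO, s ∈ M → P.toRO r ⊆ s → s ∈ F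

/-- `P` is Y-proper: for all large enough regular `θ`, for every countable `M ≺ H θ` containing `P`,
every condition of `P` in `M` has a Y-master condition for `M` below it. -/
def YProper : Prop :=
  ∃ θ₀ : Cardinal.{u}, ∀ θ : Cardinal.{u}, θ₀ ≤ θ → θ.IsRegular →
    ∀ M : ZFSet.{u}, (M : Set ZFSet.{u}).Countable → ElemSub M (H θ) → P.code ∈ M →
      ∀ p ∈ P.carrier, p ∈ M → ∃ q, P.Le q p ∧ P.IsYMaster M q

end Poset

/-! ### Ideal based forcings -/

/-- `A` is an `I`-positive subset of the first uncountable ordinal. -/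
def Positive (I A : ZFSet.{u}) : Prop := A ⊆ omegaOne ∧ A ∉ I

/-- Ideal based triples. The ordering on `U` is the set `R`: `ZFSet.pair a b ∈ R` means that
`a` precedes `b` (or is equal to it). -/
structure IsIdealBasedTriple (U R I : ZFSet.{u}) : Prop where
  finite_subset : ∀ a ∈ U, a ⊆ omegaOne ∧ (a : Set ZFSet.{u}).Finite
  rel_subset : R ⊆ ZFSet.prod U U
  refl : ∀ a ∈ U, ZFSet.pair a a ∈ R
  trans : ∀ a b c, ZFSet.pair a b ∈ R → ZFSet.pair b c ∈ R → ZFSet.pair a c ∈ R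
  refines : ∀ a b, ZFSet.pair a b ∈ R → a ⊆ b
  inter_mem : ∀ a ∈ U, ∀ β ∈ omegaOne, a ∩ β ∈ U ∧ ZFSet.pair (a ∩ β) a ∈ R
  ideal_subset : ∀ b ∈ I, b ⊆ omegaOne
  ideal_empty : ∅ ∈ I
  ideal_down : ∀ b ∈ I, ∀ c, c ⊆ b → c ∈ I
  ideal_union : ∀ b ∈ I, ∀ c ∈ I, b ∪ c ∈ I
  ideal_singleton : ∀ β ∈ omegaOne, {β} ∈ I
  countable_positive : ∀ A, Positive I A →
    ∃ B, B ⊆ A ∧ (B : Set ZFSet.{u}).Countable ∧ Positive I B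
  not_covered : ∀ a ∈ U, ∀ J, J ⊆ I → (J : Set ZFSet.{u}).Countable →
    ¬ ZFSet.sep (fun β => ZFSet.pair a (a ∪ {β}) ∈ R) omegaOne ⊆ ZFSet.sUnion J
  bad_mem : ∀ a ∈ U,
    ZFSet.sep (fun β => ZFSet.pair (a ∩ β) ((a ∩ β) ∪ {β}) ∈ R ∧ ZFSet.pair a (a ∪ {β}) ∉ R)
      omegaOne ∈ I

/-- The set `w(p)` of the ordinals occurring in `p`. -/
noncomputable def work (p : ZFSet.{u}) : ZFSet.{u} :=
  ZFSet.sep (fun α => ∃ M, ZFSet.pair M α ∈ p) omegaOne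

/-- Conditions of the ideal based forcing, with side conditions `M ≺ H κ`. -/
structure IsCondition (U I : ZFSet.{u}) (κ : Cardinal.{u}) (p : ZFSet.{u}) : Prop where
  finite : (p : Set ZFSet.{u}).Finite
  mem_pair : ∀ x ∈ p, ∃ M α, x = ZFSet.pair M α ∧ (M : Set ZFSet.{u}).Countable ∧
    ElemSub M (H κ) ∧ α ∈ omegaOne ∧ α ∉ ZFSet.sUnion (I ∩ M)
  work_mem : work p ∈ U
  chain : ∀ M α N β, ZFSet.pair M α ∈ p → ZFSet.pair N β ∈ p →
    ZFSet.pair M α ≠ ZFSet.pair N β → (M ∈ N ∧ α ∈ N) ∨ (N ∈ M ∧ β ∈ M)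

/-- The set of all conditions. -/
noncomputable def conditions (U I : ZFSet.{u}) (κ : Cardinal.{u}) : ZFSet.{u} :=
  ZFSet.sep (IsCondition U I κ) (ZFSet.powerset (ZFSet.prod (ZFSet.powerset (H κ)) omegaOne))

theorem ElemSub.subset {M N : ZFSet.{u}} (h : ElemSub M N) : M ⊆ N := by
  obtain ⟨f, hf⟩ := h
  intro x hx
  have := (f ⟨x, hx⟩).2
  rwa [hf] at this

theorem mem_conditions {U I : ZFSet.{u}} {κ : Cardinal.{u}} {p : ZFSet.{u}} :
    p ∈ conditions U I κ ↔ IsCondition U I κ p := by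
  refine ⟨fun h => (ZFSet.mem_sep.1 h).2, fun h => ZFSet.mem_sep.2 ⟨?_, h⟩⟩
  rw [ZFSet.mem_powerset]
  intro x hx
  obtain ⟨M, α, rfl, -, hM, hα, -⟩ := h.mem_pair x hx
  exact ZFSet.pair_mem_prod.2 ⟨ZFSet.mem_powerset.2 hM.subset, hα⟩

/-- The ideal based forcing given by an ideal based triple and a cardinal `κ`: `q ≤ p` if `p ⊆ q`
and `w(p)` precedes `w(q)` in the ordering of the triple. -/
noncomputable def idealForcing (U R I : ZFSet.{u}) (κ : Cardinal.{u})
    (hT : IsIdealBasedTriple U R I) : Poset.{u} where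
  carrier := conditions U I κ
  rel := ZFSet.pairSep (fun q p => p ⊆ q ∧ ZFSet.pair (work p) (work q) ∈ R)
    (conditions U I κ) (conditions U I κ)
  rel_subset := by
    intro x hx
    obtain ⟨a, ha, b, hb, rfl, -⟩ := ZFSet.mem_pairSep.1 hx
    exact ZFSet.pair_mem_prod.2 ⟨ha, hb⟩
  refl := fun p hp => ZFSet.mem_pairSep.2
    ⟨p, hp, p, hp, rfl, fun _ h => h, hT.refl _ (mem_conditions.1 hp).work_mem⟩
  trans := by
    intro p q r h₁ h₂
    obtain ⟨a, ha, b, hb, e₁, h₁, h₁'⟩ := ZFSet.mem_pairSep.1 h₁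
    obtain ⟨c, hc, d, hd, e₂, h₂, h₂'⟩ := ZFSet.mem_pairSep.1 h₂
    obtain ⟨rfl, rfl⟩ := ZFSet.pair_inj.1 e₁
    obtain ⟨rfl, rfl⟩ := ZFSet.pair_inj.1 e₂
    exact ZFSet.mem_pairSep.2
      ⟨_, ha, _, hd, rfl, fun _ h => h₁ (h₂ h), hT.trans _ _ _ h₂' h₁'⟩
  antisymm := by
    intro p q h₁ h₂
    obtain ⟨a, ha, b, hb, e₁, h₁, -⟩ := ZFSet.mem_pairSep.1 h₁
    obtain ⟨c, hc, d, hd, e₂, h₂, -⟩ := ZFSet.mem_pairSep.1 h₂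
    obtain ⟨rfl, rfl⟩ := ZFSet.pair_inj.1 e₁
    obtain ⟨rfl, rfl⟩ := ZFSet.pair_inj.1 e₂
    exact ZFSet.ext fun x => ⟨fun h => h₂ h, fun h => h₁ h⟩

/-- `P` is an ideal based forcing. -/
def IsIdealBased (P : Poset.{u}) : Prop :=
  ∃ (U R I : ZFSet.{u}) (κ : Cardinal.{u}) (hT : IsIdealBasedTriple U R I),
    κ.IsRegular ∧ I ∈ H κ ∧ P = idealForcing U R I κ hT

end YForcing

/-!
Let `P` be the ideal based forcing of a triple `U, R, I` with side conditions `M ≺ H κ`.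

*Largeness.* Call a set `D` of conditions large above a finite `t ⊆ ω₁` if there are a countable
`C ⊆ D` and a countable set `S` of ordinals such that every `a ∈ U` that adds to `t` only ordinals
above `S` precedes `a ∪ w(d)` for some `d ∈ C` with `t ⊆ w(d)` (`LargeAbove`). Two facts make this
notion work. If `D` is large above `t ∪ {β}` for an `I`-positive set of one-point extensions, then
it is large above `t`: there is a countable positive set of such `β`, and for each `a` almost all of
these `β` can be added to `a` (`IsIdealBasedTriple.largeAbove_of_successors`). If `D` contains a
condition `r`, one may therefore descend from `w(r)` through its initial segments, as long as the
models of `r` know which extensions keep `D` large: an ordinal `β` that occurs in `r` with the model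
`M` is in no set in `I ∩ M`, hence a set in `M` that contains `β` is positive
(`IsIdealBasedTriple.largeAbove_of_mem`). The elements of `C` are useful since a condition whose
models contain `C` and `S` is compatible with one of them (`IsWitness.exists_amalgam`).

*Master conditions.* Let `N` be countable and sufficiently closed. A condition `q` that has
`N ∩ H κ` as a model is Y-master for `N`. Indeed, let `r ≤ q` and `s = r ∩ (N ∩ H κ)`. A dense set
`D ∈ N` that contains `r` is large above `w(s)`, and a witness for this in `N` provides an element
of `D ∩ N` compatible with `r`. A regular open set `b ∈ N` that contains `r` is large above `w(s)`
even if one considers only extensions of `s` by models containing an arbitrary given `z` (`Robust`).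
Finitely many robust sets have a common element (`Robust.exists_forall_mem`), so the robust sets
generate a proper filter; it is in `N` since it depends only on `s`.

*Reflection.* An elementary submodel `M` of `H θ` containing `P` need not contain `U`, `R`, `I`
and `H κ`. But the argument applies to all countable `N` closed under countably many functions, and
that some set-valued function `f` on some set `K` generates a club of `N` with Y-master conditions
is a first-order property of `P`. Hence such `K` and `f` exist in `M`, the set `M ∩ K` belongs to
the club, and Y-master conditions for `M ∩ K` are Y-master for `M`
(`Poset.yProper_of_generatesClub`). The formula need not be written down: the class `Dfn` collects
the closure properties of the definable predicates.
-/

namespace YForcing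

open Cardinal

/-! ### Closure properties of `H θ` -/

section H

variable {θ : Cardinal.{u}} {x y z : ZFSet.{u}}

theorem trcl_subset_of_mem (h : y ∈ x) : trcl y ⊆ trcl x := fun _ hz =>
  mem_trcl.2 ((mem_trcl.1 hz).tail h)

theorem trcl_mono (h : x ⊆ y) : trcl x ⊆ trcl y := fun z hz => by
  rw [mem_trcl] at hz ⊢
  obtain ⟨w, hzw, hw⟩ := Relation.TransGen.tail'_iff.1 hz
  exact Relation.TransGen.tail' hzw (h hw)

theorem subset_trcl (x : ZFSet.{u}) : x ⊆ trcl x := fun _ h => mem_trcl.2 (.single h)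

theorem mem_H_of_mem (hx : x ∈ H θ) (h : y ∈ x) : y ∈ H θ :=
  mem_H.2 ((ZFSet.card_mono (trcl_subset_of_mem h)).trans_lt (mem_H.1 hx))

theorem mem_H_of_subset (hx : x ∈ H θ) (h : y ⊆ x) : y ∈ H θ :=
  mem_H.2 ((ZFSet.card_mono (trcl_mono h)).trans_lt (mem_H.1 hx))

/-- For regular `θ`, a set of size less than `θ` all of whose elements are in `H θ` is in `H θ`. -/
theorem mem_H_of_card_lt (hθ : θ.IsRegular) (hx : x ⊆ H θ) (hc : ZFSet.card x < θ) :
    x ∈ H θ := by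
  rw [mem_H]
  let g : Shrink.{u} x → ZFSet.{u} := fun i =>
    insert ((equivShrink x).symm i : ZFSet.{u}) (trcl ((equivShrink x).symm i : ZFSet.{u}))
  have hsub : trcl x ⊆ ZFSet.iUnion g := fun z hz => by
    rw [mem_trcl] at hz
    obtain ⟨w, hzw, hw⟩ := Relation.TransGen.tail'_iff.1 hz
    refine ZFSet.mem_iUnion.2 ⟨equivShrink x ⟨w, hw⟩, ?_⟩
    simp only [Equiv.symm_apply_apply, ZFSet.mem_insert_iff, mem_trcl]
    exact (Relation.reflTransGen_iff_eq_or_transGen.1 hzw).imp Eq.symm id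
  refine (ZFSet.card_mono hsub).trans_lt ?_
  have h1 := ZFSet.lift_card_iUnion_le_sum_card (f := g)
  rw [Cardinal.lift_id] at h1
  refine h1.trans_lt (Cardinal.sum_lt_of_isRegular hθ hc fun i => ?_)
  refine ZFSet.card_insert_le.trans_lt ?_
  exact Cardinal.add_lt_of_lt hθ.aleph0_le (mem_H.1 (hx ((equivShrink x).symm i).2))
    (Cardinal.one_lt_aleph0.trans_le hθ.aleph0_le)

theorem card_le_aleph0 (h : (x : Set ZFSet.{u}).Countable) : ZFSet.card x ≤ ℵ₀ := by
  rw [← Cardinal.lift_le.{u + 1}, ← ZFSet.cardinalMk_coe_sort, Cardinal.lift_aleph0]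
  exact Cardinal.mk_le_aleph0_iff.2 h.to_subtype

theorem card_lt_aleph0 (h : (x : Set ZFSet.{u}).Finite) : ZFSet.card x < ℵ₀ := by
  rw [← Cardinal.lift_lt.{u, u + 1}, ← ZFSet.cardinalMk_coe_sort, Cardinal.lift_aleph0]
  exact Cardinal.lt_aleph0_iff_finite.2 h.to_subtype

theorem mem_H_of_countable (hθ : θ.IsRegular) (hω : ℵ₀ < θ) (hx : x ⊆ H θ)
    (h : (x : Set ZFSet.{u}).Countable) : x ∈ H θ :=
  mem_H_of_card_lt hθ hx ((card_le_aleph0 h).trans_lt hω)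

theorem mem_H_of_finite (hθ : θ.IsRegular) (hx : x ⊆ H θ)
    (h : (x : Set ZFSet.{u}).Finite) : x ∈ H θ :=
  mem_H_of_card_lt hθ hx ((card_lt_aleph0 h).trans_le hθ.aleph0_le)

theorem insert_mem_H (hθ : θ.IsRegular) (hx : x ∈ H θ) (hy : y ∈ H θ) : insert x y ∈ H θ := by
  have hs : insert x y ⊆ H θ := fun z hz => by
    rcases ZFSet.mem_insert_iff.1 hz with rfl | h
    exacts [hx, mem_H_of_mem hy h]
  refine mem_H_of_card_lt hθ hs (ZFSet.card_insert_le.trans_lt ?_)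
  exact Cardinal.add_lt_of_lt hθ.aleph0_le
    ((ZFSet.card_mono (subset_trcl y)).trans_lt (mem_H.1 hy))
    (Cardinal.one_lt_aleph0.trans_le hθ.aleph0_le)

theorem empty_mem_H (hθ : θ.IsRegular) : ∅ ∈ H θ :=
  mem_H_of_finite hθ (fun _ h => absurd h (ZFSet.notMem_empty _)) (by simp)

theorem pair_mem_H (hθ : θ.IsRegular) (hx : x ∈ H θ) (hy : y ∈ H θ) : ZFSet.pair x y ∈ H θ := by
  have h0 := empty_mem_H hθ
  have hs : ∀ {a : ZFSet.{u}}, a ∈ H θ → ({a} : ZFSet.{u}) ∈ H θ := fun ha => by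
    rw [← insert_empty_eq]; exact insert_mem_H hθ ha h0
  exact insert_mem_H hθ (hs hx) (hs (insert_mem_H hθ hx (hs hy)))

theorem fst_mem_H (h : ZFSet.pair x y ∈ H θ) : x ∈ H θ :=
  mem_H_of_mem (mem_H_of_mem h (y := {x}) (by simp [ZFSet.pair])) (by simp)

theorem snd_mem_H (h : ZFSet.pair x y ∈ H θ) : y ∈ H θ :=
  mem_H_of_mem (mem_H_of_mem h (y := {x, y}) (by simp [ZFSet.pair])) (by simp)

end H

/-! ### The first uncountable ordinal -/

section omegaOne

variable {α β : ZFSet.{u}}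

theorem isOrdinal_of_mem_omegaOne (h : α ∈ omegaOne) : α.IsOrdinal :=
  (ZFSet.isOrdinal_toZFSet _).mem h

theorem countable_of_mem_omegaOne (h : α ∈ omegaOne) : (α : Set ZFSet.{u}).Countable := by
  obtain ⟨o, ho, rfl⟩ := Ordinal.mem_toZFSet_iff.1 h
  have h1 : ZFSet.card o.toZFSet ≤ ℵ₀ := by
    rw [Ordinal.card_toZFSet, ← Order.lt_succ_iff, succ_aleph0, ← Cardinal.lt_ord, ord_aleph]
    exact ho
  rw [← Cardinal.lift_le.{u + 1}, ← ZFSet.cardinalMk_coe_sort, Cardinal.lift_aleph0] at h1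
  exact Set.countable_coe_iff.1 (Cardinal.mk_le_aleph0_iff.1 h1)

theorem omegaOne_trichotomy (hα : α ∈ omegaOne) (hβ : β ∈ omegaOne) :
    α ∈ β ∨ α = β ∨ β ∈ α :=
  (isOrdinal_of_mem_omegaOne hα).mem_trichotomous (isOrdinal_of_mem_omegaOne hβ)

theorem card_omegaOne : ZFSet.card omegaOne.{u} = ℵ₁ := by
  rw [omegaOne, Ordinal.card_toZFSet, ← ord_aleph, card_ord]

end omegaOne

/-! ### First-order definability over a set -/

/-- Environments: iterated products `((PUnit × T) × T) × ⋯`, seen as valuations of finitely many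
variables in `T`. -/
class Env (T : ZFSet.{u}) (α : Type (u + 1)) where
  /-- The type of variables. -/
  Var : Type
  /-- The value of a variable. -/
  get : Var → α → T

instance (T : ZFSet.{u}) : Env T PUnit.{u + 2} := ⟨Empty, fun v _ => v.elim⟩

instance (T : ZFSet.{u}) (α : Type (u + 1)) [Env T α] : Env T (α × T) :=
  ⟨Env.Var T α ⊕ Fin 1, fun v a => Sum.elim (fun w => Env.get w a.1) (fun _ => a.2) v⟩

section Definability

variable {T : ZFSet.{u}} {α : Type (u + 1)} [Env T α]

variable (T) in
/-- The function `t` reads off the value of a variable. -/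
class IsVar (t : α → ZFSet.{u}) : Prop where
  exists_var : ∃ v : Env.Var T α, ∀ a, t a = Env.get v a

variable (T) in
/-- The predicate `p` of environments is given by a first-order formula over `(T, ∈)`. -/
class Dfn (p : α → Prop) : Prop where
  exists_formula : ∃ φ : setLanguage.Formula (Env.Var T α),
    ∀ a, φ.Realize (fun v => Env.get v a) ↔ p a

/-- The set `T` is transitive and closed under subsets. -/
class SubsetClosed (T : ZFSet.{u}) : Prop where
  mem_of_mem : ∀ x ∈ T, ∀ y ∈ x, y ∈ T
  mem_of_subset : ∀ x ∈ T, ∀ y, y ⊆ x → y ∈ T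

instance (θ : Cardinal.{u}) : SubsetClosed (H θ) :=
  ⟨fun _ hx _ h => mem_H_of_mem hx h, fun _ hx _ h => mem_H_of_subset hx h⟩

/-- The last variable. The instances `isVar_fst₂`, …, `isVar_snd₁`, … below repeat `isVar_snd` and
`isVar_fst` under several quantifiers: unification finds no `t` with `t a.1 = a.1.1.2`. -/
instance isVar_snd : IsVar T (fun a : α × T => (a.2 : ZFSet.{u})) := ⟨.inr 0, fun _ => rfl⟩

section

variable {t : α → ZFSet.{u}} [ht : IsVar T t]

instance isVar_fst : IsVar T (fun a : α × T => t a.1) := by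
  obtain ⟨v, hv⟩ := ht.exists_var
  exact ⟨.inl v, fun a => hv a.1⟩

instance isVar_fst₂ : IsVar T (fun a : (α × T) × T => t a.1.1) :=
  isVar_fst (t := fun a : α × T => t a.1)

instance isVar_fst₃ : IsVar T (fun a : ((α × T) × T) × T => t a.1.1.1) :=
  isVar_fst (t := fun a : (α × T) × T => t a.1.1)

instance isVar_fst₄ : IsVar T (fun a : (((α × T) × T) × T) × T => t a.1.1.1.1) :=
  isVar_fst (t := fun a : ((α × T) × T) × T => t a.1.1.1)

end

instance isVar_snd₁ : IsVar T (fun a : (α × T) × T => (a.1.2 : ZFSet.{u})) :=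
  isVar_fst (t := fun a : α × T => (a.2 : ZFSet.{u}))

instance isVar_snd₂ : IsVar T (fun a : ((α × T) × T) × T => (a.1.1.2 : ZFSet.{u})) :=
  isVar_fst (t := fun a : (α × T) × T => (a.1.2 : ZFSet.{u}))

instance isVar_snd₃ : IsVar T (fun a : (((α × T) × T) × T) × T => (a.1.1.1.2 : ZFSet.{u})) :=
  isVar_fst (t := fun a : ((α × T) × T) × T => (a.1.1.2 : ZFSet.{u}))

instance isVar_snd₄ :
    IsVar T (fun a : ((((α × T) × T) × T) × T) × T => (a.1.1.1.1.2 : ZFSet.{u})) :=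
  isVar_fst (t := fun a : (((α × T) × T) × T) × T => (a.1.1.1.2 : ZFSet.{u}))

/-- The membership symbol of the language of set theory. -/
def memSymbol : setLanguage.Relations 2 := SetRel.mem

section Connectives

variable {p q : α → Prop} {t s r : α → ZFSet.{u}}

theorem Dfn.congr (h : ∀ a, p a ↔ q a) [hp : Dfn T p] : Dfn T q := by
  obtain ⟨φ, hφ⟩ := hp.exists_formula
  exact ⟨φ, fun a => (hφ a).trans (h a)⟩

instance dfn_mem [ht : IsVar T t] [hs : IsVar T s] : Dfn T (fun a => t a ∈ s a) := by
  obtain ⟨v, hv⟩ := ht.exists_var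
  obtain ⟨w, hw⟩ := hs.exists_var
  refine ⟨memSymbol.formula₂ (.var v) (.var w), fun a => ?_⟩
  rw [FirstOrder.Language.Formula.realize_rel₂, hv, hw]
  rfl

instance dfn_eq [ht : IsVar T t] [hs : IsVar T s] : Dfn T (fun a => t a = s a) := by
  obtain ⟨v, hv⟩ := ht.exists_var
  obtain ⟨w, hw⟩ := hs.exists_var
  refine ⟨FirstOrder.Language.Term.equal (.var v) (.var w), fun a => ?_⟩
  rw [FirstOrder.Language.Formula.realize_equal, hv, hw, Subtype.ext_iff]
  rfl

instance dfn_not [hp : Dfn T p] : Dfn T (fun a => ¬ p a) := by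
  obtain ⟨φ, hφ⟩ := hp.exists_formula
  exact ⟨φ.not, fun a => by rw [FirstOrder.Language.Formula.realize_not, hφ]⟩

instance dfn_imp [hp : Dfn T p] [hq : Dfn T q] : Dfn T (fun a => p a → q a) := by
  obtain ⟨φ, hφ⟩ := hp.exists_formula
  obtain ⟨ψ, hψ⟩ := hq.exists_formula
  exact ⟨φ.imp ψ, fun a => by rw [FirstOrder.Language.Formula.realize_imp, hφ, hψ]⟩

instance dfn_and [Dfn T p] [Dfn T q] : Dfn T (fun a => p a ∧ q a) :=
  Dfn.congr (p := fun a => ¬ (p a → ¬ q a)) fun a => by tauto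

instance dfn_or [Dfn T p] [Dfn T q] : Dfn T (fun a => p a ∨ q a) :=
  Dfn.congr (p := fun a => ¬ p a → q a) fun a => by tauto

instance dfn_iff [Dfn T p] [Dfn T q] : Dfn T (fun a => p a ↔ q a) :=
  Dfn.congr (p := fun a => (p a → q a) ∧ (q a → p a)) fun a => by tauto

theorem Dfn.exists_formula_prod {p : α → T → Prop} [hp : Dfn T (fun a : α × T => p a.1 a.2)] :
    ∃ φ : setLanguage.Formula (Env.Var T α ⊕ Fin 1),
      ∀ a x, φ.Realize (Sum.elim (fun v => Env.get v a) fun _ => x) ↔ p a x := by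
  obtain ⟨φ, hφ⟩ := hp.exists_formula
  refine ⟨φ, fun a x => (iff_of_eq (congrArg φ.Realize (funext fun v => ?_))).trans (hφ (a, x))⟩
  rcases v with v | v <;> rfl

instance dfn_ex {p : α → T → Prop} [hp : Dfn T (fun a : α × T => p a.1 a.2)] :
    Dfn T (fun a => ∃ x, p a x) := by
  obtain ⟨φ, hφ⟩ := Dfn.exists_formula_prod (p := p)
  refine ⟨FirstOrder.Language.Formula.iExs (Fin 1) φ, fun a => ?_⟩
  rw [FirstOrder.Language.Formula.realize_iExs]
  constructor
  · rintro ⟨i, hi⟩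
    obtain ⟨y, rfl⟩ : ∃ y, i = fun _ => y :=
      ⟨i 0, funext fun j => congrArg i (Subsingleton.elim j 0)⟩
    exact ⟨y, (hφ a y).1 hi⟩
  · rintro ⟨x, hx⟩
    exact ⟨fun _ => x, (hφ a x).2 hx⟩

instance dfn_all {p : α → T → Prop} [Dfn T (fun a : α × T => p a.1 a.2)] :
    Dfn T (fun a => ∀ x, p a x) :=
  Dfn.congr (p := fun a => ¬ ∃ x, ¬ p a x) fun a => by simp

variable [hT : SubsetClosed T]

/-- Quantifiers over all sets that are bounded by a variable may be read as quantifiers over `T`. -/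
instance dfn_ball {p : α → ZFSet.{u} → Prop} [ht : IsVar T t]
    [Dfn T (fun a : α × T => p a.1 a.2)] : Dfn T (fun a => ∀ x ∈ t a, p a x) :=
  Dfn.congr (p := fun a => ∀ x : T, (x : ZFSet.{u}) ∈ t a → p a x) fun a => by
    obtain ⟨v, hv⟩ := ht.exists_var
    exact ⟨fun h x hx => h ⟨x, hT.mem_of_mem (t a) (hv a ▸ Subtype.prop _) x hx⟩ hx,
      fun h x hx => h x hx⟩

instance dfn_bex {p : α → ZFSet.{u} → Prop} [ht : IsVar T t]
    [Dfn T (fun a : α × T => p a.1 a.2)] : Dfn T (fun a => ∃ x ∈ t a, p a x) :=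
  Dfn.congr (p := fun a => ¬ ∀ x ∈ t a, ¬ p a x) fun a => by simp

instance dfn_ball_subset {p : α → ZFSet.{u} → Prop} [ht : IsVar T t]
    [Dfn T (fun a : α × T => p a.1 a.2)] : Dfn T (fun a => ∀ x, x ⊆ t a → p a x) :=
  Dfn.congr (p := fun a => ∀ x : T, (x : ZFSet.{u}) ⊆ t a → p a x) fun a => by
    obtain ⟨v, hv⟩ := ht.exists_var
    exact ⟨fun h x hx => h ⟨x, hT.mem_of_subset (t a) (hv a ▸ Subtype.prop _) x hx⟩ hx,
      fun h x hx => h x hx⟩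

instance dfn_eq_insert [IsVar T t] [IsVar T s] [IsVar T r] :
    Dfn T (fun a => t a = insert (s a) (r a)) :=
  Dfn.congr (p := fun a => s a ∈ t a ∧ r a ⊆ t a ∧ ∀ x ∈ t a, x = s a ∨ x ∈ r a) fun a => by
    rw [ZFSet.ext_iff]
    simp only [ZFSet.mem_insert_iff]
    refine ⟨fun h x => ⟨h.2.2 x, ?_⟩, fun h => ⟨(h _).2 (.inl rfl), fun x hx => (h x).2 (.inr hx),
      fun x hx => (h x).1 hx⟩⟩
    rintro (rfl | hx)
    exacts [h.1, h.2.1 hx]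

instance dfn_eq_empty [IsVar T t] : Dfn T (fun a => t a = ∅) :=
  Dfn.congr (p := fun a => ∀ x ∈ t a, ¬ x ∈ t a) fun a => by
    rw [ZFSet.eq_empty]
    exact ⟨fun h y hy => h y hy hy, fun h y hy => absurd hy (h y)⟩

instance dfn_empty_mem [IsVar T t] : Dfn T (fun a => ∅ ∈ t a) :=
  Dfn.congr (p := fun a => ∃ x ∈ t a, x = ∅) fun a => by simp

instance dfn_eq_pair [IsVar T t] [IsVar T s] [IsVar T r] :
    Dfn T (fun a => t a = ZFSet.pair (s a) (r a)) :=
  Dfn.congr (p := fun a => (∃ x ∈ t a, ∃ y ∈ t a, (∀ z ∈ t a, z = x ∨ z = y) ∧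
      (∀ z ∈ x, z = s a) ∧ s a ∈ x ∧ (∀ z ∈ y, z = s a ∨ z = r a) ∧ s a ∈ y ∧ r a ∈ y))
    fun a => by
      constructor
      · rintro ⟨x, hx, y, hy, h1, h2, h3, h4, h5, h6⟩
        have ex : x = {s a} := by
          ext z; rw [ZFSet.mem_singleton]
          exact ⟨h2 z, fun h => h ▸ h3⟩
        have ey : y = {s a, r a} := by
          ext z; rw [ZFSet.mem_pair]
          exact ⟨h4 z, fun h => h.elim (fun h => h ▸ h5) (fun h => h ▸ h6)⟩
        ext z
        rw [ZFSet.pair, ZFSet.mem_pair, ← ex, ← ey]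
        exact ⟨h1 z, fun h => h.elim (fun h => h ▸ hx) (fun h => h ▸ hy)⟩
      · intro h
        rw [h]
        simp [ZFSet.pair]

instance dfn_pair_mem [IsVar T t] [IsVar T s] [IsVar T r] :
    Dfn T (fun a => ZFSet.pair (t a) (s a) ∈ r a) :=
  Dfn.congr (p := fun a => ∃ z ∈ r a, z = ZFSet.pair (t a) (s a)) fun a => by simp

end Connectives

end Definability

/-! ### Elementary submodels -/

section ElemSub

variable {M T : ZFSet.{u}}

/-- One half of the Tarski–Vaught criterion: a definable predicate with parameters in `M ≺ T` that
has a witness in `T` has one in `M`. -/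
theorem ElemSub.exists_mem (h : ElemSub M T) {α : Type (u + 1)} [Env T α] {p : α → T → Prop}
    [hp : Dfn T (fun a : α × T => p a.1 a.2)] (a : α)
    (ha : ∀ v : Env.Var T α, (Env.get v a : ZFSet.{u}) ∈ M) (hx : ∃ x, p a x) :
    ∃ x : T, (x : ZFSet.{u}) ∈ M ∧ p a x := by
  obtain ⟨φ, hφ⟩ := Dfn.exists_formula_prod (p := p)
  obtain ⟨f, hf⟩ := h
  let v : Env.Var T α → M := fun i => ⟨Env.get i a, ha i⟩
  have hv : f ∘ v = fun i => Env.get i a := funext fun i => Subtype.ext (hf _)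
  obtain ⟨x, hx⟩ := hx
  have h1 : (FirstOrder.Language.Formula.iExs (Fin 1) φ).Realize (f ∘ v) := by
    rw [FirstOrder.Language.Formula.realize_iExs, hv]
    exact ⟨fun _ => x, (hφ a x).2 hx⟩
  rw [f.map_formula, FirstOrder.Language.Formula.realize_iExs] at h1
  obtain ⟨i, hi⟩ := h1
  obtain ⟨y, rfl⟩ : ∃ y, i = fun _ => y :=
    ⟨i 0, funext fun j => congrArg i (Subsingleton.elim j 0)⟩
  refine ⟨f y, hf y ▸ y.2, (hφ a _).1 ?_⟩
  rw [← f.map_formula, Sum.comp_elim, hv] at hi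
  exact hi

theorem ElemSub.exists_mem₁ (h : ElemSub M T) {p : ZFSet.{u} → ZFSet.{u} → Prop}
    [hp : Dfn T (fun a : (PUnit.{u + 2} × T) × T => p a.1.2 a.2)]
    {x : ZFSet.{u}} (hx : x ∈ M) (hw : ∃ w ∈ T, p x w) : ∃ w ∈ M, p x w := by
  obtain ⟨w, hw, hp'⟩ := hw
  obtain ⟨w, hw⟩ := h.exists_mem (α := PUnit.{u + 2} × T) (p := fun a w => p a.2 w)
    ⟨⟨⟩, ⟨x, h.subset hx⟩⟩ (by rintro (⟨⟨⟩⟩ | _); exact hx) ⟨⟨w, hw⟩, hp'⟩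
  exact ⟨w, hw⟩

theorem ElemSub.exists_mem₂ (h : ElemSub M T) {p : ZFSet.{u} → ZFSet.{u} → ZFSet.{u} → Prop}
    [hp : Dfn T (fun a : ((PUnit.{u + 2} × T) × T) × T => p a.1.1.2 a.1.2 a.2)]
    {x y : ZFSet.{u}} (hx : x ∈ M) (hy : y ∈ M) (hw : ∃ w ∈ T, p x y w) : ∃ w ∈ M, p x y w := by
  obtain ⟨w, hw, hp'⟩ := hw
  obtain ⟨w, hw⟩ := h.exists_mem (α := (PUnit.{u + 2} × T) × T) (p := fun a w => p a.1.2 a.2 w)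
    ⟨⟨⟨⟩, ⟨x, h.subset hx⟩⟩, ⟨y, h.subset hy⟩⟩
    (by rintro ((⟨⟨⟩⟩ | _) | _); exacts [hx, hy]) ⟨⟨w, hw⟩, hp'⟩
  exact ⟨w, hw⟩

theorem ElemSub.exists_mem₃ (h : ElemSub M T)
    {p : ZFSet.{u} → ZFSet.{u} → ZFSet.{u} → ZFSet.{u} → Prop}
    [hp : Dfn T (fun a : (((PUnit.{u + 2} × T) × T) × T) × T => p a.1.1.1.2 a.1.1.2 a.1.2 a.2)]
    {x y z : ZFSet.{u}} (hx : x ∈ M) (hy : y ∈ M) (hz : z ∈ M) (hw : ∃ w ∈ T, p x y z w) :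
    ∃ w ∈ M, p x y z w := by
  obtain ⟨w, hw, hp'⟩ := hw
  obtain ⟨w, hw⟩ := h.exists_mem (α := ((PUnit.{u + 2} × T) × T) × T)
    (p := fun a w => p a.1.1.2 a.1.2 a.2 w)
    ⟨⟨⟨⟨⟩, ⟨x, h.subset hx⟩⟩, ⟨y, h.subset hy⟩⟩, ⟨z, h.subset hz⟩⟩
    (by rintro (((⟨⟨⟩⟩ | _) | _) | _); exacts [hx, hy, hz]) ⟨⟨w, hw⟩, hp'⟩
  exact ⟨w, hw⟩

variable {θ : Cardinal.{u}} {x y z : ZFSet.{u}}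

theorem ElemSub.insert_mem (hθ : θ.IsRegular) (h : ElemSub M (H θ)) (hx : x ∈ M) (hy : y ∈ M) :
    insert x y ∈ M := by
  obtain ⟨w, hw, rfl⟩ := h.exists_mem₂ (p := fun x y w => w = insert x y) hx hy
    ⟨_, insert_mem_H hθ (h.subset hx) (h.subset hy), rfl⟩
  exact hw

theorem ElemSub.pair_mem (hθ : θ.IsRegular) (h : ElemSub M (H θ)) (hx : x ∈ M) (hy : y ∈ M) :
    ZFSet.pair x y ∈ M := by
  obtain ⟨w, hw, rfl⟩ := h.exists_mem₂ (p := fun x y w => w = ZFSet.pair x y) hx hy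
    ⟨_, pair_mem_H hθ (h.subset hx) (h.subset hy), rfl⟩
  exact hw

theorem ElemSub.empty_mem (hθ : θ.IsRegular) (h : ElemSub M (H θ)) (hx : x ∈ M) : ∅ ∈ M := by
  obtain ⟨w, hw, rfl⟩ := h.exists_mem₁ (p := fun _ w => w = ∅) hx ⟨_, empty_mem_H hθ, rfl⟩
  exact hw

/-- The natural number `n` as a von Neumann ordinal. -/
noncomputable def num : ℕ → ZFSet.{u}
  | 0 => ∅
  | n + 1 => insert (num n) (num n)

theorem num_injective : Function.Injective num.{u} := by
  have h : ∀ n : ℕ, num.{u} n = Ordinal.toZFSet n := fun n => by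
    induction n with
    | zero => simp [num]
    | succ n ih => rw [num, ih, Nat.cast_succ, Ordinal.toZFSet_add_one]
  intro m n hmn
  rw [h, h] at hmn
  exact Nat.cast_injective (Ordinal.toZFSet_injective hmn)

theorem num_mem_H (hθ : θ.IsRegular) : ∀ n, num n ∈ H θ
  | 0 => empty_mem_H hθ
  | n + 1 => insert_mem_H hθ (num_mem_H hθ n) (num_mem_H hθ n)

/-- The first-order description of `ω` among the sets. -/
def IsOmega (w : ZFSet.{u}) : Prop :=
  ∅ ∈ w ∧ (∀ x ∈ w, ∃ y ∈ w, y = insert x x) ∧ ∀ y ∈ w, y = ∅ ∨ ∃ x ∈ w, y = insert x x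

theorem IsOmega.mem_iff {w : ZFSet.{u}} (h : IsOmega w) : x ∈ w ↔ ∃ n, num n = x := by
  constructor
  · induction x using ZFSet.inductionOn with
    | _ x ih =>
      intro hx
      rcases h.2.2 x hx with rfl | ⟨y, hy, rfl⟩
      · exact ⟨0, rfl⟩
      · obtain ⟨n, rfl⟩ := ih y (ZFSet.mem_insert _ _) hy
        exact ⟨n + 1, rfl⟩
  · rintro ⟨n, rfl⟩
    induction n with
    | zero => exact h.1
    | succ n ih =>
      obtain ⟨y, hy, rfl⟩ := h.2.1 _ ih
      exact hy

theorem isOmega_range_num : IsOmega (ZFSet.range num.{u}) := by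
  refine ⟨ZFSet.mem_range.2 ⟨0, rfl⟩, fun x hx => ?_, fun y hy => ?_⟩
  · obtain ⟨n, rfl⟩ := ZFSet.mem_range.1 hx
    exact ⟨_, ZFSet.mem_range.2 ⟨n + 1, rfl⟩, rfl⟩
  · obtain ⟨_ | n, rfl⟩ := ZFSet.mem_range.1 hy
    · exact .inl rfl
    · exact .inr ⟨_, ZFSet.mem_range.2 ⟨n, rfl⟩, rfl⟩

/-- `e` is a set of pairs that attaches to every element of `c` an element of `w`, to distinct
elements distinct ones. -/
def Enumerates (e w c : ZFSet.{u}) : Prop :=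
  (∀ x ∈ c, ∃ n ∈ w, ZFSet.pair n x ∈ e) ∧
    ∀ n ∈ w, ∀ x ∈ c, ∀ y ∈ c, ZFSet.pair n x ∈ e → ZFSet.pair n y ∈ e → x = y

/-- The first-order description of countability, relativized to `T`. -/
def CountableIn (T c : ZFSet.{u}) : Prop := ∃ w e : T, IsOmega w ∧ Enumerates e w c

instance dfn_countableIn {T : ZFSet.{u}} [SubsetClosed T] {α : Type (u + 1)} [Env T α]
    {t : α → ZFSet.{u}} [IsVar T t] : Dfn T (fun a => CountableIn T (t a)) := by
  unfold CountableIn IsOmega Enumerates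
  infer_instance

theorem CountableIn.countable {T c : ZFSet.{u}} (h : CountableIn T c) :
    (c : Set ZFSet.{u}).Countable := by
  obtain ⟨w, e, hw, h1, h2⟩ := h
  have h3 : ∀ x : c, ∃ n : ℕ, ZFSet.pair (num n) x ∈ (e : ZFSet.{u}) := fun x => by
    obtain ⟨n, hn, hx⟩ := h1 x x.2
    obtain ⟨n, rfl⟩ := hw.mem_iff.1 hn
    exact ⟨n, hx⟩
  choose g hg using h3
  refine Set.countable_coe_iff.1 (Function.Injective.countable (f := g) fun x y hxy => ?_)
  exact Subtype.ext (h2 _ (hw.mem_iff.2 ⟨g x, rfl⟩) x x.2 y y.2 (hg x) (hxy ▸ hg y))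

theorem countableIn_H (hθ : θ.IsRegular) (hω : ℵ₀ < θ) {c : ZFSet.{u}} (hc : c ∈ H θ)
    (h : (c : Set ZFSet.{u}).Countable) : CountableIn (H θ) c := by
  obtain ⟨g, hg⟩ := (Set.countable_coe_iff.2 h).exists_injective_nat
  have : Countable c := Set.countable_coe_iff.2 h
  refine ⟨⟨ZFSet.range num, mem_H_of_countable hθ hω ?_ ?_⟩,
    ⟨ZFSet.range fun x : c => ZFSet.pair (num (g x)) x, mem_H_of_countable hθ hω ?_ ?_⟩,
    isOmega_range_num, ?_, ?_⟩
  · intro x hx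
    obtain ⟨n, rfl⟩ := ZFSet.mem_range.1 hx
    exact num_mem_H hθ n
  · rw [ZFSet.coe_range]; exact Set.countable_range _
  · intro x hx
    obtain ⟨y, rfl⟩ := ZFSet.mem_range.1 hx
    exact pair_mem_H hθ (num_mem_H hθ _) (mem_H_of_mem hc y.2)
  · rw [ZFSet.coe_range]; exact Set.countable_range _
  · exact fun x hx => ⟨_, ZFSet.mem_range.2 ⟨g ⟨x, hx⟩, rfl⟩, ZFSet.mem_range.2 ⟨⟨x, hx⟩, rfl⟩⟩
  · intro n _ x _ y _ hx hy
    obtain ⟨x', hx'⟩ := ZFSet.mem_range.1 hx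
    obtain ⟨y', hy'⟩ := ZFSet.mem_range.1 hy
    obtain ⟨rfl, rfl⟩ := ZFSet.pair_inj.1 hx'
    obtain ⟨h1, rfl⟩ := ZFSet.pair_inj.1 hy'
    rw [hg (num_injective h1)]

theorem ElemSub.num_mem (hθ : θ.IsRegular) (h : ElemSub M (H θ)) (hx : x ∈ M) :
    ∀ n, num n ∈ M
  | 0 => h.empty_mem hθ hx
  | n + 1 => h.insert_mem hθ (h.num_mem hθ hx n) (h.num_mem hθ hx n)

/-- Countable elements of an elementary submodel are subsets. -/
theorem ElemSub.subset_of_countable (hθ : θ.IsRegular) (hω : ℵ₀ < θ) (h : ElemSub M (H θ))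
    {c : ZFSet.{u}} (hc : c ∈ M) (hcc : (c : Set ZFSet.{u}).Countable) : c ⊆ M := by
  obtain ⟨w, e, hw, he⟩ := countableIn_H hθ hω (h.subset hc) hcc
  obtain ⟨e', he', w', hw', h1, h2⟩ := h.exists_mem₁
    (p := fun c e => ∃ w : H θ, IsOmega w ∧ Enumerates e w c)
    (hp := by unfold IsOmega Enumerates; infer_instance) hc ⟨e, e.2, w, hw, he⟩
  intro x hx
  obtain ⟨n, hn, hnx⟩ := h1 x hx
  obtain ⟨m, rfl⟩ := hw'.mem_iff.1 hn
  obtain ⟨y, hy, hyc, hny⟩ := h.exists_mem₃ (p := fun n e c x => x ∈ c ∧ ZFSet.pair n x ∈ e)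
    (h.num_mem hθ hc m) he' hc ⟨x, mem_H_of_mem (h.subset hc) hx, hx, hnx⟩
  rwa [h2 _ hn x hx y hyc hnx hny]

theorem ElemSub.fst_snd_mem (hθ : θ.IsRegular) (hω : ℵ₀ < θ) (h : ElemSub M (H θ))
    (hx : ZFSet.pair x y ∈ M) : x ∈ M ∧ y ∈ M := by
  have h1 : ({x, y} : ZFSet.{u}) ∈ M := h.subset_of_countable hθ hω hx
    (by rw [ZFSet.coe_pair]; exact Set.to_countable _) (by simp [ZFSet.pair])
  have h2 := h.subset_of_countable hθ hω h1
    (by rw [ZFSet.coe_insert, ZFSet.coe_singleton]; exact Set.to_countable _)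
  exact ⟨h2 (by simp), h2 (by simp)⟩

theorem ElemSub.mem_of_finite (hθ : θ.IsRegular) (h : ElemSub M (H θ)) (hM : ∅ ∈ M)
    (hx : x ⊆ M) (hf : (x : Set ZFSet.{u}).Finite) : x ∈ M := by
  have : ∀ s : Set ZFSet.{u}, s.Finite → s ⊆ (M : Set ZFSet.{u}) →
      ∃ y ∈ M, (y : Set ZFSet.{u}) = s := by
    intro s hs
    induction s, hs using Set.Finite.induction_on with
    | empty => exact fun _ => ⟨∅, hM, by simp⟩
    | @insert a s _ _ ih =>
      intro hsM
      obtain ⟨y, hy, rfl⟩ := ih ((Set.subset_insert _ _).trans hsM)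
      exact ⟨insert a y, h.insert_mem hθ (hsM (Set.mem_insert _ _)) hy, by simp⟩
  obtain ⟨y, hy, hyx⟩ := this x hf hx
  rwa [← SetLike.coe_injective hyx]

end ElemSub

/-! ### Reflecting a club of submodels into an elementary submodel -/

section Reflection

/-! The following predicates spell out the notions of `Poset` with all quantifiers bounded, for a
poset with underlying set `C` and ordering `E`. -/

/-- Compatibility, in bounded form. -/
def CompatIn (C E p q : ZFSet.{u}) : Prop := ∃ r ∈ C, ZFSet.pair r p ∈ E ∧ ZFSet.pair r q ∈ E

/-- Density, in bounded form. -/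
def DenseIn (C E D : ZFSet.{u}) : Prop := D ⊆ C ∧ ∀ p ∈ C, ∃ d ∈ D, ZFSet.pair d p ∈ E

/-- Membership in the completion, in bounded form. -/
def ROIn (C E b : ZFSet.{u}) : Prop :=
  b ⊆ C ∧ ∀ p ∈ C, p ∈ b ↔ ∀ q ∈ C, ZFSet.pair q p ∈ E → ∃ r ∈ C, ZFSet.pair r q ∈ E ∧ r ∈ b

/-- The relation `s ≥ r` between an element of the completion and a condition, in bounded form. -/
def ConeIn (C E r s : ZFSet.{u}) : Prop :=
  ∀ x ∈ C, (∀ y ∈ C, ZFSet.pair y x ∈ E → CompatIn C E y r) → x ∈ s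

/-- Filters on the completion, in bounded form. -/
def FilterIn (C E F : ZFSet.{u}) : Prop :=
  (∀ b ∈ F, ROIn C E b) ∧ (∃ b ∈ F, b ∈ F) ∧ ¬ ∅ ∈ F ∧
    (∀ b ∈ F, ∀ c, c ⊆ C → ROIn C E c → b ⊆ c → c ∈ F) ∧
    ∀ b ∈ F, ∀ c ∈ F, ∃ d ∈ F, d ⊆ b ∧ d ⊆ c

/-- Y-master conditions, in bounded form. -/
def YMasterIn (C E N q : ZFSet.{u}) : Prop :=
  (∀ D ∈ N, DenseIn C E D → ∀ r ∈ C, ZFSet.pair r q ∈ E → ∃ d ∈ D, d ∈ N ∧ CompatIn C E d r) ∧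
    ∀ r ∈ C, ZFSet.pair r q ∈ E →
      ∃ F ∈ N, FilterIn C E F ∧ ∀ s ∈ N, ROIn C E s → ConeIn C E r s → s ∈ F

/-- Every condition in `N` has a Y-master condition for `N` below it, in bounded form. -/
def YMasterExistsIn (C E N : ZFSet.{u}) : Prop :=
  ∀ p ∈ C, p ∈ N → ∃ q ∈ C, ZFSet.pair q p ∈ E ∧ YMasterIn C E N q

/-- `N` is a subset of `K` closed under pairing and under the set-valued function `f`, in the sense
that the values of `f` at elements of `N` are subsets of `N`. -/
def ClosedIn (T K f N : ZFSet.{u}) : Prop :=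
  N ⊆ K ∧ (∀ x ∈ N, ∀ y ∈ N, ∀ z ∈ K, z = ZFSet.pair x y → z ∈ N) ∧
    ∀ x ∈ N, ∀ c : T, ZFSet.pair x c ∈ f → (c : ZFSet.{u}) ⊆ N

/-- The set-valued function `f` on `K` generates a club of countable sets for which there are
Y-master conditions; this is a first-order property in `T`. -/
def GeneratesClub (T C E K f : ZFSet.{u}) : Prop :=
  C ⊆ K ∧ (∀ s, s ⊆ C → s ∈ K) ∧
    (∀ x c c' : T, ZFSet.pair (x : ZFSet.{u}) c ∈ f → ZFSet.pair (x : ZFSet.{u}) c' ∈ f →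
      (c : ZFSet.{u}) = c') ∧
    (∀ x c : T, ZFSet.pair (x : ZFSet.{u}) c ∈ f → (c : ZFSet.{u}) ⊆ K ∧ CountableIn T c) ∧
    ∀ N : T, CountableIn T N → ClosedIn T K f N → YMasterExistsIn C E N

section Definability

variable {T : ZFSet.{u}} [SubsetClosed T] {α : Type (u + 1)} [Env T α]
  {C E s t v : α → ZFSet.{u}} [IsVar T C] [IsVar T E] [IsVar T s] [IsVar T t] [IsVar T v]

instance : Dfn T (fun a => CompatIn (C a) (E a) (s a) (t a)) := by
  unfold CompatIn; infer_instance

instance : Dfn T (fun a => DenseIn (C a) (E a) (s a)) := by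
  unfold DenseIn; infer_instance

instance : Dfn T (fun a => ROIn (C a) (E a) (s a)) := by
  unfold ROIn; infer_instance

instance : Dfn T (fun a => ConeIn (C a) (E a) (s a) (t a)) := by
  unfold ConeIn; infer_instance

instance : Dfn T (fun a => FilterIn (C a) (E a) (s a)) := by
  unfold FilterIn; infer_instance

instance : Dfn T (fun a => YMasterIn (C a) (E a) (s a) (t a)) := by
  unfold YMasterIn; infer_instance

instance : Dfn T (fun a => YMasterExistsIn (C a) (E a) (s a)) := by
  unfold YMasterExistsIn; infer_instance

instance : Dfn T (fun a => ClosedIn T (s a) (t a) (v a)) := by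
  unfold ClosedIn; infer_instance

instance : Dfn T (fun a => GeneratesClub T (C a) (E a) (s a) (t a)) := by
  unfold GeneratesClub; infer_instance

end Definability

namespace Poset

variable {P : Poset.{u}} {p q r s F N M : ZFSet.{u}}

theorem Le.left_mem (h : P.Le q p) : q ∈ P.carrier := (ZFSet.pair_mem_prod.1 (P.rel_subset h)).1

theorem Le.right_mem (h : P.Le q p) : p ∈ P.carrier := (ZFSet.pair_mem_prod.1 (P.rel_subset h)).2

theorem compatIn_iff : CompatIn P.carrier P.rel p q ↔ P.Compat p q :=
  ⟨fun ⟨r, _, h⟩ => ⟨r, h⟩, fun ⟨r, h⟩ => ⟨r, h.1.left_mem, h⟩⟩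

theorem roIn_iff : ROIn P.carrier P.rel s ↔ s ∈ P.RO := by
  rw [RO, ZFSet.mem_sep, ZFSet.mem_powerset]
  refine and_congr_right fun _ => forall₂_congr fun p _ => iff_congr Iff.rfl ?_
  refine ⟨fun h q hq => ?_, fun h q _ hq => ?_⟩
  · obtain ⟨r, _, hr⟩ := h q (Le.left_mem hq) hq
    exact ⟨r, hr⟩
  · obtain ⟨r, hr⟩ := h q hq
    exact ⟨r, hr.1.left_mem, hr⟩

theorem coneIn_iff : ConeIn P.carrier P.rel r s ↔ P.toRO r ⊆ s := by
  refine ⟨fun h x hx => ?_, fun h x hx hxr => h (ZFSet.mem_sep.2 ⟨hx, fun y hy => ?_⟩)⟩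
  · obtain ⟨hx, hxr⟩ := ZFSet.mem_sep.1 hx
    exact h x hx fun y _ hy => compatIn_iff.2 (hxr y hy)
  · exact compatIn_iff.1 (hxr y (Le.left_mem hy) hy)

theorem filterIn_iff : FilterIn P.carrier P.rel F ↔ P.IsFilterRO F := by
  constructor
  · rintro ⟨h1, ⟨b, hb, -⟩, h3, h4, h5⟩
    refine ⟨fun b hb => roIn_iff.1 (h1 b hb), ⟨b, hb⟩, h3, fun b hb c hc hbc => ?_, h5⟩
    exact h4 b hb c (roIn_iff.2 hc).1 (roIn_iff.2 hc) hbc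
  · intro h
    obtain ⟨b, hb⟩ := h.nonempty
    exact ⟨fun b hb => roIn_iff.2 (h.subset hb), ⟨b, hb, hb⟩, h.empty_notMem,
      fun b hb c _ hc hbc => h.mem_of_subset b hb c (roIn_iff.1 hc) hbc, h.directed⟩

theorem IsYMaster.yMasterIn (h : P.IsYMaster N q) : YMasterIn P.carrier P.rel N q := by
  refine ⟨fun D hD hd r _ hr => ?_, fun r _ hr => ?_⟩
  · obtain ⟨d, hdD, hdN, hdr⟩ := h.1 D hD hd r hr
    exact ⟨d, hdD, hdN, compatIn_iff.2 hdr⟩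
  · obtain ⟨F, hF, hf, hs⟩ := h.2 r hr
    exact ⟨F, hF, filterIn_iff.2 hf,
      fun s hsN hs' hrs => hs s (roIn_iff.1 hs') hsN (coneIn_iff.1 hrs)⟩

/-- Y-masterness for `N` depends only on the subsets of the poset in `N` and on the filters in
`N`. -/
theorem isYMaster_of_yMasterIn (h : YMasterIn P.carrier P.rel N q) (hNM : N ⊆ M)
    (hMN : ∀ s ∈ M, s ⊆ P.carrier → s ∈ N) : P.IsYMaster M q := by
  refine ⟨fun D hD hd r hr => ?_, fun r hr => ?_⟩
  · obtain ⟨d, hdD, hdN, hdr⟩ := h.1 D (hMN D hD hd.1) hd r (Le.left_mem hr) hr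
    exact ⟨d, hdD, hNM hdN, compatIn_iff.1 hdr⟩
  · obtain ⟨F, hF, hf, hs⟩ := h.2 r (Le.left_mem hr) hr
    exact ⟨F, hNM hF, filterIn_iff.1 hf, fun s hs' hsM hrs =>
      hs s (hMN s hsM (roIn_iff.2 hs').1) (roIn_iff.2 hs') (coneIn_iff.2 hrs)⟩

/-- If some set-valued function `f` generates a club of countable sets with Y-master conditions,
then the poset is Y-proper: a submodel `M` containing the poset contains such a function by
elementarity, and then `M ∩ K` belongs to the club. -/
theorem yProper_of_generatesClub {K f : ZFSet.{u}}
    (h : ∀ θ : Cardinal.{u}, θ.IsRegular → ℵ₀ < θ → K ∈ H θ → f ∈ H θ → P.code ∈ H θ →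
      GeneratesClub (H θ) P.carrier P.rel K f) : P.YProper := by
  refine ⟨Order.succ (max ℵ₀ (ZFSet.card (trcl (ZFSet.pair P.code (ZFSet.pair K f))))), ?_⟩
  intro θ hθ₀ hθ M hMc hM hPM p hp hpM
  rw [Order.succ_le_iff, max_lt_iff] at hθ₀
  obtain ⟨hω, hx⟩ := hθ₀
  replace hx := mem_H.2 hx
  have hKf := snd_mem_H hx
  have hG := h θ hθ hω (fst_mem_H hKf) (snd_mem_H hKf) (fst_mem_H hx)
  obtain ⟨hC, hE⟩ := hM.fst_snd_mem hθ hω hPM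
  obtain ⟨K', hK', f', hG⟩ := hM.exists_mem₂
    (p := fun C E K => ∃ f : H θ, GeneratesClub (H θ) C E K f) hC hE
    ⟨K, fst_mem_H hKf, ⟨f, snd_mem_H hKf⟩, hG⟩
  obtain ⟨f', hf', hCK, hPK, hfun, hcount, hclub⟩ := hM.exists_mem₃
    (p := fun C E K f => GeneratesClub (H θ) C E K f) hC hE hK' ⟨f', f'.2, hG⟩
  have hNM : M ∩ K' ⊆ M := fun x hx => (ZFSet.mem_inter.1 hx).1
  have hNc : ((M ∩ K' : ZFSet.{u}) : Set ZFSet.{u}).Countable := hMc.mono hNM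
  have hNH : M ∩ K' ∈ H θ := mem_H_of_countable hθ hω (fun x hx => hM.subset (hNM hx)) hNc
  have hclosed : ClosedIn (H θ) K' f' (M ∩ K') := by
    refine ⟨fun x hx => (ZFSet.mem_inter.1 hx).2, ?_, fun x hx c hc y hy => ?_⟩
    · rintro x hx y hy z hz rfl
      exact ZFSet.mem_inter.2 ⟨hM.pair_mem hθ (hNM hx) (hNM hy), hz⟩
    · obtain ⟨c', hc'M, hc'⟩ := hM.exists_mem₂ (p := fun x f c => ZFSet.pair x c ∈ f)
        (hNM hx) hf' ⟨c, c.2, hc⟩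
      obtain rfl : (c : ZFSet.{u}) = c' :=
        hfun ⟨x, hM.subset (hNM hx)⟩ c ⟨c', hM.subset hc'M⟩ hc hc'
      obtain ⟨hcK, hcc⟩ := hcount ⟨x, hM.subset (hNM hx)⟩ c hc
      exact ZFSet.mem_inter.2 ⟨hM.subset_of_countable hθ hω hc'M hcc.countable hy, hcK hy⟩
  obtain ⟨q, _, hqp, hq⟩ := hclub ⟨_, hNH⟩ (countableIn_H hθ hω hNH hNc) hclosed p hp
    (ZFSet.mem_inter.2 ⟨hpM, hCK hp⟩)
  exact ⟨q, hqp, isYMaster_of_yMasterIn hq hNM fun s hs hsP => ZFSet.mem_inter.2 ⟨hs, hPK s hsP⟩⟩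

end Poset

/-- A finite sequence of sets, coded as a set by iterated pairing. -/
noncomputable def listCode : List ZFSet.{u} → ZFSet.{u}
  | [] => ∅
  | a :: l => ZFSet.pair a (listCode l)

theorem listCode_injective : Function.Injective listCode.{u} := by
  have h : ∀ a b : ZFSet.{u}, ∅ ≠ ZFSet.pair a b := fun a b h =>
    ZFSet.notMem_empty {a} (h ▸ by simp [ZFSet.pair])
  intro l
  induction l with
  | nil =>
    rintro (_ | ⟨b, m⟩) e
    exacts [rfl, absurd e (h _ _)]
  | cons a l ih =>
    rintro (_ | ⟨b, m⟩) e
    · exact absurd e.symm (h _ _)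
    · obtain ⟨rfl, h'⟩ := ZFSet.pair_inj.1 e
      rw [ih h']

/-- To prove Y-properness it is enough to find Y-master conditions for all countable sets closed
under countably many given finitary functions. -/
theorem Poset.yProper_of_closed (P : Poset.{u}) {ι : Type*} [Countable ι]
    (h : ι → List ZFSet.{u} → ZFSet.{u}) (K : ZFSet.{u}) (hK : ∅ ∈ K)
    (hpair : ∀ x ∈ K, ∀ y ∈ K, ZFSet.pair x y ∈ K) (hPK : P.carrier ⊆ K)
    (hsub : ∀ s, s ⊆ P.carrier → s ∈ K)
    (hN : ∀ N : ZFSet.{u}, N ⊆ K → (N : Set ZFSet.{u}).Countable →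
      (∀ i l, (∀ x ∈ l, x ∈ N) → h i l ∈ K → h i l ∈ N) →
      ∀ p ∈ P.carrier, p ∈ N → ∃ q, P.Le q p ∧ P.IsYMaster N q) : P.YProper := by
  -- The value at `x` collects the values of all the functions at the sequence coded by `x`. It also
  -- contains `∅`, the code of the empty sequence.
  let v : ZFSet.{u} → ZFSet.{u} := fun x =>
    ZFSet.sep (fun y => y = ∅ ∨ ∃ i l, listCode l = x ∧ h i l = y) K
  have hv : ∀ x, (v x : Set ZFSet.{u}).Countable := fun x => by
    by_cases hx : ∃ l, listCode l = x
    · obtain ⟨l, rfl⟩ := hx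
      refine ((Set.countable_singleton ∅).union (Set.countable_range fun i => h i l)).mono ?_
      intro y hy
      rcases (ZFSet.mem_sep.1 hy).2 with rfl | ⟨i, m, hm, rfl⟩
      · exact .inl rfl
      · exact .inr ⟨i, by rw [listCode_injective hm]⟩
    · refine (Set.countable_singleton ∅).mono fun y hy => ?_
      rcases (ZFSet.mem_sep.1 hy).2 with rfl | ⟨i, m, hm, -⟩
      exacts [rfl, absurd ⟨m, hm⟩ hx]
  refine P.yProper_of_generatesClub (K := K) (f := ZFSet.range fun x : K => ZFSet.pair x (v x)) ?_
  intro θ hθ hω hKθ hfθ hPθ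
  have hf : ∀ x c, ZFSet.pair x c ∈ ZFSet.range (fun x : K => ZFSet.pair x (v x)) ↔
      x ∈ K ∧ c = v x := fun x c => by
    rw [ZFSet.mem_range]
    constructor
    · rintro ⟨y, hy⟩
      obtain ⟨rfl, rfl⟩ := ZFSet.pair_inj.1 hy
      exact ⟨y.2, rfl⟩
    · rintro ⟨hx, rfl⟩
      exact ⟨⟨x, hx⟩, rfl⟩
  refine ⟨hPK, hsub, fun x c c' hc hc' => ?_, fun x c hc => ?_, fun N hNc hNcl => ?_⟩
  · rw [((hf _ _).1 hc).2, ((hf _ _).1 hc').2]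
  · refine ⟨?_, countableIn_H hθ hω c.2 ?_⟩
    all_goals rw [((hf _ _).1 hc).2]
    exacts [fun y hy => (ZFSet.mem_sep.1 hy).1, hv _]
  · obtain ⟨hNK, hNp, hNf⟩ := hNcl
    have hvH : ∀ x, v x ∈ H θ := fun x =>
      mem_H_of_subset hKθ fun y hy => (ZFSet.mem_sep.1 hy).1
    have hvN : ∀ x ∈ (N : ZFSet.{u}), v x ⊆ N := fun x hx =>
      hNf x hx ⟨v x, hvH x⟩ ((hf _ _).2 ⟨hNK hx, rfl⟩)
    intro p hp hpN
    have h0 : ∅ ∈ (N : ZFSet.{u}) := hvN p hpN (ZFSet.mem_sep.2 ⟨hK, .inl rfl⟩)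
    have hcode : ∀ l : List ZFSet.{u},
        (∀ x ∈ l, x ∈ (N : ZFSet.{u})) → listCode l ∈ (N : ZFSet.{u}) := by
      intro l
      induction l with
      | nil => exact fun _ => h0
      | cons a l ih =>
        intro hl
        have h1 := hl a (by simp)
        have h2 := ih fun x hx => hl x (by simp [hx])
        exact hNp a h1 _ h2 _ (hpair _ (hNK h1) _ (hNK h2)) rfl
    obtain ⟨q, hqp, hq⟩ := hN N hNK hNc.countable (fun i l hl hil =>
      hvN _ (hcode l hl) (ZFSet.mem_sep.2 ⟨hil, .inr ⟨i, l, rfl, rfl⟩⟩)) p hp hpN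
    exact ⟨q, Poset.Le.left_mem hqp, hqp, hq.yMasterIn⟩

end Reflection

/-! ### Skolem functions -/

section Skolem

open Classical in
/-- Skolem functions for the existential formulas over `T`, as functions of finite sequences. -/
noncomputable def skolem (T : ZFSet.{u}) (φ : Σ n, setLanguage.BoundedFormula Empty (n + 1))
    (l : List ZFSet.{u}) : ZFSet.{u} :=
  if h : ∃ (a : T) (x : Fin φ.1 → T), List.ofFn (fun i => (x i : ZFSet.{u})) = l ∧
      φ.2.Realize default (Fin.snoc x a : Fin (φ.1 + 1) → T)
  then h.choose else ∅

theorem skolem_spec {T : ZFSet.{u}} {n : ℕ} (φ : setLanguage.BoundedFormula Empty (n + 1))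
    (x : Fin n → T) (h : ∃ a : T, φ.Realize default (Fin.snoc x a : Fin (n + 1) → T)) :
    ∃ a : T, (a : ZFSet.{u}) = skolem T ⟨n, φ⟩ (List.ofFn fun i => (x i : ZFSet.{u})) ∧
      φ.Realize default (Fin.snoc x a : Fin (n + 1) → T) := by
  obtain ⟨a, ha⟩ := h
  have h : ∃ (a : T) (y : Fin n → T), List.ofFn (fun i => (y i : ZFSet.{u})) =
      List.ofFn (fun i => (x i : ZFSet.{u})) ∧
        φ.Realize default (Fin.snoc y a : Fin (n + 1) → T) := ⟨a, x, rfl, ha⟩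
  refine ⟨h.choose, ?_, ?_⟩
  · unfold skolem
    rw [dif_pos h]
  · obtain ⟨y, hy, hφ⟩ := h.choose_spec
    obtain rfl : y = x := funext fun i => Subtype.ext (congrFun (List.ofFn_injective hy) i)
    exact hφ

/-- The Tarski–Vaught test. -/
theorem elemSub_of_skolem {M T : ZFSet.{u}} (hMT : M ⊆ T)
    (h : ∀ φ l, (∀ x ∈ l, x ∈ M) → skolem T φ l ∈ T → skolem T φ l ∈ M) : ElemSub M T := by
  let f : M ↪[setLanguage] T :=
    { toFun := fun x => ⟨x, hMT x.2⟩
      inj' := fun x y h => Subtype.ext (congrArg (fun z : T => (z : ZFSet.{u})) h)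
      map_fun' := fun g => Empty.elim g
      map_rel' := fun R _ => by cases R; exact Iff.rfl }
  refine ⟨f.toElementaryEmbedding fun n φ x a ha => ?_, fun x => rfl⟩
  obtain ⟨b, hb, hφ⟩ := skolem_spec φ (f ∘ x) ⟨a, ha⟩
  refine ⟨⟨b, ?_⟩, hφ⟩
  rw [hb]
  refine h _ _ (fun y hy => ?_) (hb ▸ b.2)
  obtain ⟨i, rfl⟩ := (List.mem_ofFn' _ _).1 hy
  exact (x i).2

instance : Countable (Σ n, setLanguage.BoundedFormula Empty (n + 1)) := by
  have : Countable setLanguage.Symbols := by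
    have h1 : Countable (Σ l, setLanguage.Functions l) :=
      @Subsingleton.to_countable _ ⟨fun a => Empty.elim a.2⟩
    have h2 : Countable (Σ l, setLanguage.Relations l) :=
      @Subsingleton.to_countable _ ⟨fun ⟨_, a⟩ ⟨_, b⟩ => by cases a; cases b; rfl⟩
    exact inferInstanceAs (Countable (_ ⊕ _))
  refine Function.Injective.countable
    (f := fun φ : Σ n, setLanguage.BoundedFormula Empty (n + 1) =>
      (⟨φ.1 + 1, φ.2⟩ : Σ n, setLanguage.BoundedFormula Empty n)) ?_
  rintro ⟨m, φ⟩ ⟨n, ψ⟩ h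
  obtain ⟨h1, h2⟩ := Sigma.mk.inj_iff.1 h
  obtain rfl : m = n := by simpa using h1
  exact congrArg _ (eq_of_heq h2)

end Skolem

/-! ### Ideal based triples -/

section Triple

variable {U R I : ZFSet.{u}} {κ : Cardinal.{u}} {A M N a t p r e d s α β γ D : ZFSet.{u}}

theorem IsIdealBasedTriple.mem_H_of_mem_omegaOne (hT : IsIdealBasedTriple U R I) (hI : I ∈ H κ)
    (hβ : β ∈ omegaOne) : β ∈ H κ :=
  mem_H_of_mem (mem_H_of_mem hI (hT.ideal_singleton β hβ)) (by simp)

theorem IsIdealBasedTriple.aleph_one_lt (hT : IsIdealBasedTriple U R I) (hI : I ∈ H κ) :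
    ℵ₁ < κ := by
  rw [← card_omegaOne]
  refine (ZFSet.card_mono fun β hβ => ?_).trans_lt (mem_H.1 hI)
  exact mem_trcl.2 (.head (ZFSet.mem_singleton.2 rfl) (.single (hT.ideal_singleton β hβ)))

theorem IsIdealBasedTriple.aleph0_lt (hT : IsIdealBasedTriple U R I) (hI : I ∈ H κ) :
    ℵ₀ < κ := aleph0_lt_aleph_one.trans (hT.aleph_one_lt hI)

theorem IsIdealBasedTriple.omegaOne_mem_H (hT : IsIdealBasedTriple U R I) (hκ : κ.IsRegular)
    (hI : I ∈ H κ) : omegaOne ∈ H κ :=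
  mem_H_of_card_lt hκ (fun _ h => hT.mem_H_of_mem_omegaOne hI h)
    (card_omegaOne.trans_lt (hT.aleph_one_lt hI))

theorem IsIdealBasedTriple.right_mem (hT : IsIdealBasedTriple U R I) (h : ZFSet.pair a t ∈ R) :
    t ∈ U := (ZFSet.pair_mem_prod.1 (hT.rel_subset h)).2

/-- Initial segments of an element of `U` belong to `U` and precede it. -/
theorem IsIdealBasedTriple.rel_of_initial (hT : IsIdealBasedTriple U R I) (ha : a ∈ U)
    (hta : t ⊆ a) (h : ∀ γ ∈ a, γ ∉ t → ∀ β ∈ t, β ∈ γ) : t ∈ U ∧ ZFSet.pair t a ∈ R := by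
  by_cases hat : a ⊆ t
  · obtain rfl : t = a := ZFSet.ext fun x => ⟨fun hx => hta hx, fun hx => hat hx⟩
    exact ⟨ha, hT.refl _ ha⟩
  · have hne : a \ t ≠ ∅ := fun h0 => hat fun x hx => by
      by_contra hxt
      exact ZFSet.notMem_empty x (h0 ▸ ZFSet.mem_sdiff.2 ⟨hx, hxt⟩)
    obtain ⟨γ, hγ, hmin⟩ := ZFSet.regularity _ hne
    obtain ⟨hγa, hγt⟩ := ZFSet.mem_sdiff.1 hγ
    have e : a ∩ γ = t := by
      ext x
      rw [ZFSet.mem_inter]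
      refine ⟨fun ⟨hxa, hxγ⟩ => ?_, fun hx => ⟨hta hx, h γ hγa hγt x hx⟩⟩
      by_contra hxt
      exact ZFSet.notMem_empty x
        (hmin ▸ ZFSet.mem_inter.2 ⟨ZFSet.mem_sdiff.2 ⟨hxa, hxt⟩, hxγ⟩)
    exact e ▸ hT.inter_mem a ha γ ((hT.finite_subset a ha).1 hγa)

/-- `U` has size at most `ℵ₁`. -/
theorem IsIdealBasedTriple.card_lt (hT : IsIdealBasedTriple U R I) (hI : I ∈ H κ) :
    ZFSet.card U < κ := by
  refine lt_of_le_of_lt ?_ (hT.aleph_one_lt hI)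
  have hω : #(omegaOne.{u} : ZFSet.{u}) = lift.{u + 1, u} ℵ₁ := by
    rw [ZFSet.cardinalMk_coe_sort, card_omegaOne]
  have : Infinite (omegaOne.{u} : ZFSet.{u}) := by
    rw [Cardinal.infinite_iff, hω]; simp
  rw [← Cardinal.lift_le.{u + 1}, ← ZFSet.cardinalMk_coe_sort, ← hω,
    ← Cardinal.mk_finset_of_infinite (omegaOne.{u} : ZFSet.{u})]
  have hfin : ∀ t : U,
      {x : (omegaOne.{u} : ZFSet.{u}) | (x : ZFSet.{u}) ∈ (t : ZFSet.{u})}.Finite :=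
    fun t => (hT.finite_subset t t.2).2.preimage Subtype.val_injective.injOn
  refine Cardinal.mk_le_of_injective (f := fun t : U => (hfin t).toFinset) fun t t' h => ?_
  replace h := Set.Finite.toFinset_inj.1 h
  refine Subtype.ext (ZFSet.ext fun x => ⟨fun hx => ?_, fun hx => ?_⟩)
  · exact (Set.ext_iff.1 h ⟨x, (hT.finite_subset t t.2).1 hx⟩).1 hx
  · exact (Set.ext_iff.1 h ⟨x, (hT.finite_subset t' t'.2).1 hx⟩).2 hx

/-- The countable set `C` of elements of `D`, together with the countable set `S` of ordinals,
witnesses that `D` is large above `t`: every element of `U` that adds to `t` only ordinals above `S`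
precedes its union with the work set of some element of `C`. -/
structure IsWitness (U R D t C S : ZFSet.{u}) : Prop where
  subset : C ⊆ D
  subset_omegaOne : S ⊆ omegaOne
  countable : (C : Set ZFSet.{u}).Countable
  countable' : (S : Set ZFSet.{u}).Countable
  exists_mem : ∀ a ∈ U, t ⊆ a → (∀ γ ∈ a, γ ∉ t → ∀ x ∈ S, x ∈ γ) →
    ∃ d ∈ C, t ⊆ work d ∧ ZFSet.pair a (a ∪ work d) ∈ R

/-- The set of conditions `D` is large above `t`. -/
def LargeAbove (U R D t : ZFSet.{u}) : Prop := ∃ C S, IsWitness U R D t C S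

/-- The set of those `β` above `t` such that `t` precedes `t ∪ {β}` and `D` is large above
`t ∪ {β}`. -/
noncomputable def largeSuccessors (U R D t : ZFSet.{u}) : ZFSet.{u} :=
  ZFSet.sep (fun β => (∀ γ ∈ t, γ ∈ β) ∧ ZFSet.pair t (t ∪ {β}) ∈ R ∧ LargeAbove U R D (t ∪ {β}))
    omegaOne

theorem mem_work : α ∈ work p ↔ α ∈ omegaOne ∧ ∃ M, ZFSet.pair M α ∈ p := ZFSet.mem_sep

theorem IsIdealBasedTriple.largeAbove_work (hT : IsIdealBasedTriple U R I) (hd : d ∈ D) :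
    LargeAbove U R D (work d) := by
  refine ⟨{d}, ∅, by simpa [ZFSet.subset_def] using hd, by simp, by simp, by simp, ?_⟩
  intro a ha hda _
  refine ⟨d, by simp, fun _ h => h, ?_⟩
  have e : a ∪ work d = a := ZFSet.ext fun x => by
    rw [ZFSet.mem_union]; exact ⟨fun h => h.elim id fun h => hda h, .inl⟩
  rw [e]
  exact hT.refl a ha

/-- Largeness propagates downwards along positively many one-point extensions: replace the
positive set of extensions by a countable positive subset, and take the union of the witnesses. -/
theorem IsIdealBasedTriple.largeAbove_of_successors (hT : IsIdealBasedTriple U R I)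
    (h : largeSuccessors U R D t ∉ I) : LargeAbove U R D t := by
  obtain ⟨B, hB, hBc, hBpos⟩ := hT.countable_positive (largeSuccessors U R D t)
    ⟨fun x hx => (ZFSet.mem_sep.1 hx).1, h⟩
  have hB' : ∀ β : B, LargeAbove U R D (t ∪ {(β : ZFSet.{u})}) := fun β =>
    (ZFSet.mem_sep.1 (hB β.2)).2.2.2
  choose C S hCS using hB'
  have : Countable B := Set.countable_coe_iff.2 hBc
  refine ⟨ZFSet.iUnion C, B ∪ ZFSet.iUnion S, ?_, ?_, ?_, ?_, ?_⟩
  · intro x hx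
    obtain ⟨β, hβ⟩ := ZFSet.mem_iUnion.1 hx
    exact (hCS β).subset hβ
  · intro x hx
    rcases ZFSet.mem_union.1 hx with hx | hx
    · exact hBpos.1 hx
    · obtain ⟨β, hβ⟩ := ZFSet.mem_iUnion.1 hx
      exact (hCS β).subset_omegaOne hβ
  · rw [ZFSet.coe_iUnion]
    exact Set.countable_iUnion fun β => (hCS β).countable
  · rw [ZFSet.coe_union, ZFSet.coe_iUnion]
    exact hBc.union (Set.countable_iUnion fun β => (hCS β).countable')
  · intro a ha hta haS
    obtain ⟨β, hβB, hβ⟩ : ∃ β ∈ B, β ∉ ZFSet.sep (fun β =>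
        ZFSet.pair (a ∩ β) ((a ∩ β) ∪ {β}) ∈ R ∧ ZFSet.pair a (a ∪ {β}) ∉ R) omegaOne := by
      by_contra! hcon
      exact hBpos.2 (hT.ideal_down _ (hT.bad_mem a ha) B fun x hx => hcon x hx)
    obtain ⟨hβω, htβ, htR, -⟩ := ZFSet.mem_sep.1 (hB hβB)
    have e : a ∩ β = t := by
      ext x
      rw [ZFSet.mem_inter]
      refine ⟨fun ⟨hxa, hxβ⟩ => ?_, fun hx => ⟨hta hx, htβ x hx⟩⟩
      by_contra hxt
      exact ZFSet.mem_asymm hxβ (haS x hxa hxt β (ZFSet.mem_union.2 (.inl hβB)))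
    have haβ : ZFSet.pair a (a ∪ {β}) ∈ R := by
      by_contra hcon
      exact hβ (ZFSet.mem_sep.2 ⟨hβω, e.symm ▸ htR, hcon⟩)
    obtain ⟨d, hdC, hd, hdR⟩ := (hCS ⟨β, hβB⟩).exists_mem (a ∪ {β}) (hT.right_mem haβ)
      (fun x hx => ZFSet.mem_union.2 ((ZFSet.mem_union.1 hx).imp_left fun h => hta h))
      (fun γ hγ hγt x hx => by
        rw [ZFSet.mem_union, not_or] at hγt
        exact haS γ ((ZFSet.mem_union.1 hγ).resolve_right hγt.2) hγt.1 x
          (ZFSet.mem_union.2 (.inr (ZFSet.mem_iUnion.2 ⟨⟨β, hβB⟩, hx⟩))))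
    refine ⟨d, ZFSet.mem_iUnion.2 ⟨⟨β, hβB⟩, hdC⟩, fun x hx => hd (ZFSet.mem_union.2 (.inl hx)), ?_⟩
    have e' : a ∪ {β} ∪ work d = a ∪ work d := by
      have hβd : β ∈ work d := hd (ZFSet.mem_union.2 (.inr (by simp)))
      ext x
      simp only [ZFSet.mem_union, ZFSet.mem_singleton]
      constructor
      · rintro ((h | rfl) | h)
        exacts [.inl h, .inr hβd, .inr h]
      · rintro (h | h)
        exacts [.inl (.inl h), .inr h]
    exact hT.trans _ _ _ haβ (e' ▸ hdR)

/-- The function `t ↦ largeSuccessors U R D t` on `U`, as a set. -/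
noncomputable def largeSuccessorsMap (U R D : ZFSet.{u}) : ZFSet.{u} :=
  ZFSet.range fun t : U => ZFSet.pair t (largeSuccessors U R D t)

theorem IsIdealBasedTriple.largeSuccessorsMap_mem_H (hT : IsIdealBasedTriple U R I)
    (hκ : κ.IsRegular) (hI : I ∈ H κ) : largeSuccessorsMap U R D ∈ H κ := by
  refine mem_H_of_card_lt hκ (fun x hx => ?_) ?_
  · obtain ⟨t, rfl⟩ := ZFSet.mem_range.1 hx
    refine pair_mem_H hκ (mem_H_of_subset (hT.omegaOne_mem_H hκ hI) (hT.finite_subset t t.2).1) ?_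
    exact mem_H_of_subset (hT.omegaOne_mem_H hκ hI) fun y hy => (ZFSet.mem_sep.1 hy).1
  · refine lt_of_le_of_lt ?_ (hT.card_lt hI)
    have h := ZFSet.lift_card_range_le (f := fun t : U => ZFSet.pair t (largeSuccessors U R D t))
    rw [ZFSet.cardinalMk_coe_sort] at h
    simpa [largeSuccessorsMap] using h

/-! ### Conditions of the ideal based forcing -/

/-- A countable elementary submodel contains an initial segment of `ω₁`. -/
theorem ElemSub.mem_of_notMem (hκ : κ.IsRegular) (hω : ℵ₀ < κ) (hA : ElemSub A (H κ))
    (hβ : β ∈ omegaOne) (hγ : γ ∈ omegaOne) (hβA : β ∈ A) (hγA : γ ∉ A) : β ∈ γ := by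
  rcases omegaOne_trichotomy hβ hγ with h | rfl | h
  · exact h
  · exact absurd hβA hγA
  · exact absurd (hA.subset_of_countable hκ hω hβA (countable_of_mem_omegaOne hβ) h) hγA

theorem IsIdealBasedTriple.notMem_of_notMem_sUnion (hT : IsIdealBasedTriple U R I)
    (hκ : κ.IsRegular) (hA : ElemSub A (H κ)) (hα : α ∈ omegaOne)
    (h : α ∉ ZFSet.sUnion (I ∩ A)) : α ∉ A := fun hαA => by
  refine h (ZFSet.mem_sUnion.2 ⟨{α}, ZFSet.mem_inter.2 ⟨hT.ideal_singleton α hα, ?_⟩, by simp⟩)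
  rw [← insert_empty_eq]
  exact hA.insert_mem hκ hαA (hA.empty_mem hκ hαA)

theorem IsCondition.model (hp : IsCondition U I κ p) (h : ZFSet.pair M α ∈ p) :
    (M : Set ZFSet.{u}).Countable ∧ ElemSub M (H κ) ∧ α ∈ omegaOne ∧
      α ∉ ZFSet.sUnion (I ∩ M) := by
  obtain ⟨N, β, e, h⟩ := hp.mem_pair _ h
  obtain ⟨rfl, rfl⟩ := ZFSet.pair_inj.1 e
  exact h

theorem IsIdealBasedTriple.notMem_model (hT : IsIdealBasedTriple U R I) (hκ : κ.IsRegular)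
    (hp : IsCondition U I κ p) (h : ZFSet.pair M α ∈ p) : α ∉ M :=
  hT.notMem_of_notMem_sUnion hκ (hp.model h).2.1 (hp.model h).2.2.1 (hp.model h).2.2.2

theorem IsIdealBasedTriple.condition_mem_H (hT : IsIdealBasedTriple U R I) (hκ : κ.IsRegular)
    (hI : I ∈ H κ) (hp : IsCondition U I κ p) : p ∈ H κ := by
  refine mem_H_of_finite hκ (fun x hx => ?_) hp.finite
  obtain ⟨M, α, rfl, hMc, hM, hα, -⟩ := hp.mem_pair x hx
  exact pair_mem_H hκ (mem_H_of_countable hκ (hT.aleph0_lt hI) hM.subset hMc)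
    (hT.mem_H_of_mem_omegaOne hI hα)

/-- Of the models of a condition, those outside the model `A` of the condition include it. -/
theorem IsCondition.subset_of_notMem (hκ : κ.IsRegular) (hω : ℵ₀ < κ) (hr : IsCondition U I κ r)
    (hA : ZFSet.pair A α ∈ r) (hN : ZFSet.pair N γ ∈ r) (h : ZFSet.pair N γ ∉ A) : A ⊆ N := by
  by_cases e : ZFSet.pair A α = ZFSet.pair N γ
  · rw [(ZFSet.pair_inj.1 e).1]
  · rcases hr.chain A α N γ hA hN e with h' | h'
    · exact (hr.model hN).2.1.subset_of_countable hκ hω h'.1 (hr.model hA).1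
    · exact absurd ((hr.model hA).2.1.pair_mem hκ h'.1 h'.2) h

theorem IsIdealBasedTriple.work_inter (hT : IsIdealBasedTriple U R I) (hκ : κ.IsRegular)
    (hI : I ∈ H κ) (hr : IsCondition U I κ r) (hA : ZFSet.pair A α ∈ r) :
    work (r ∩ A) = work r ∩ A := by
  ext β
  simp only [ZFSet.mem_inter, mem_work]
  constructor
  · rintro ⟨hβ, M, hM, hMA⟩
    exact ⟨⟨hβ, M, hM⟩, ((hr.model hA).2.1.fst_snd_mem hκ (hT.aleph0_lt hI) hMA).2⟩
  · rintro ⟨⟨hβ, M, hM⟩, hβA⟩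
    refine ⟨hβ, M, hM, ?_⟩
    by_contra hMA
    exact hT.notMem_model hκ hr hM (hr.subset_of_notMem hκ (hT.aleph0_lt hI) hA hM hMA hβA)

theorem IsIdealBasedTriple.isCondition_inter (hT : IsIdealBasedTriple U R I) (hκ : κ.IsRegular)
    (hI : I ∈ H κ) (hr : IsCondition U I κ r) (hA : ZFSet.pair A α ∈ r) :
    IsCondition U I κ (r ∩ A) where
  finite := hr.finite.subset fun x hx => (ZFSet.mem_inter.1 hx).1
  mem_pair x hx := hr.mem_pair x (ZFSet.mem_inter.1 hx).1
  work_mem := by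
    rw [hT.work_inter hκ hI hr hA]
    refine (hT.rel_of_initial hr.work_mem (fun x hx => (ZFSet.mem_inter.1 hx).1) ?_).1
    intro γ hγ hγA β hβ
    rw [ZFSet.mem_inter] at hβ hγA
    exact (hr.model hA).2.1.mem_of_notMem hκ (hT.aleph0_lt hI) (mem_work.1 hβ.1).1
      (mem_work.1 hγ).1 hβ.2 fun h => hγA ⟨hγ, h⟩
  chain M α N β hM hN := hr.chain M α N β (ZFSet.mem_inter.1 hM).1 (ZFSet.mem_inter.1 hN).1

/-- If `D` contains the condition `r`, and `A` is a model of `r` that knows which extensions keep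
`D` large, then `D` is large above the initial segments of `w(r)` that include `w(r) ∩ A`. For
`w(r)` itself this is trivial, and a model `M` of `r` with ordinal `β` shows that one may pass from
an initial segment with last element `β` to its predecessor `t`: the set of good one-point
extensions of `t` is in `M` and contains `β`, so that it cannot be in the ideal. -/
theorem IsIdealBasedTriple.largeAbove_of_mem (hT : IsIdealBasedTriple U R I) (hκ : κ.IsRegular)
    (hI : I ∈ H κ) (hr : IsCondition U I κ r) (hrD : r ∈ D) (hA : ZFSet.pair A α ∈ r)
    (hDA : largeSuccessorsMap U R D ∈ A) (t : ZFSet.{u}) (htr : t ⊆ work r)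
    (hti : ∀ γ ∈ work r, γ ∉ t → ∀ β ∈ t, β ∈ γ) (htA : ∀ γ ∈ work r, γ ∈ A → γ ∈ t) :
    LargeAbove U R D t := by
  have hω := hT.aleph0_lt hI
  have hfin : (work r : Set ZFSet.{u}).Finite := (hT.finite_subset _ hr.work_mem).2
  induction hn : ((work r \ t : ZFSet.{u}) : Set ZFSet.{u}).ncard using Nat.strong_induction_on
    generalizing t with
  | _ n ih =>
    by_cases hrt : work r \ t = ∅
    · obtain rfl : work r = t := ZFSet.ext fun x => ⟨fun hx => by
        by_contra hxt
        exact ZFSet.notMem_empty x (hrt ▸ ZFSet.mem_sdiff.2 ⟨hx, hxt⟩), fun hx => htr hx⟩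
      exact hT.largeAbove_work hrD
    · obtain ⟨β, hβ, hmin⟩ := ZFSet.regularity _ hrt
      obtain ⟨hβr, hβt⟩ := ZFSet.mem_sdiff.1 hβ
      obtain ⟨hβω, M, hM⟩ := mem_work.1 hβr
      obtain ⟨hMc, hMe, -, hβM⟩ := hr.model hM
      have hmin' : ∀ γ ∈ work r, γ ∉ t → γ ≠ β → β ∈ γ := fun γ hγ hγt hne => by
        rcases omegaOne_trichotomy hβω (mem_work.1 hγ).1 with h | h | h
        · exact h
        · exact absurd h.symm hne
        · exact absurd (hmin ▸ ZFSet.mem_inter.2 ⟨ZFSet.mem_sdiff.2 ⟨hγ, hγt⟩, h⟩)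
            (ZFSet.notMem_empty γ)
      have ht'r : t ∪ {β} ⊆ work r := fun x hx => by
        rcases ZFSet.mem_union.1 hx with h | h
        · exact htr h
        · rwa [ZFSet.mem_singleton.1 h]
      have ht'i : ∀ γ ∈ work r, γ ∉ t ∪ {β} → ∀ δ ∈ t ∪ {β}, δ ∈ γ := fun γ hγ hγt δ hδ => by
        rw [ZFSet.mem_union, ZFSet.mem_singleton, not_or] at hγt
        rcases ZFSet.mem_union.1 hδ with h | h
        · exact hti γ hγ hγt.1 δ h
        · exact ZFSet.mem_singleton.1 h ▸ hmin' γ hγ hγt.1 hγt.2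
      have ht'U := (hT.rel_of_initial hr.work_mem ht'r ht'i).1
      have htU := (hT.rel_of_initial hr.work_mem htr hti).1
      have hlarge : LargeAbove U R D (t ∪ {β}) := by
        refine ih _ ?_ _ ht'r ht'i
          (fun γ hγ hγA => ZFSet.mem_union.2 (.inl (htA γ hγ hγA))) rfl
        rw [← hn]
        refine Set.ncard_lt_ncard ?_ (hfin.subset fun x hx => (ZFSet.mem_sdiff.1 hx).1)
        refine ⟨fun x hx => ?_, fun h => ?_⟩
        · obtain ⟨h1, h2⟩ := ZFSet.mem_sdiff.1 hx
          exact ZFSet.mem_sdiff.2 ⟨h1, fun h => h2 (ZFSet.mem_union.2 (.inl h))⟩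
        · exact (ZFSet.mem_sdiff.1 (h hβ)).2 (ZFSet.mem_union.2 (.inr (by simp)))
      have hβX : β ∈ largeSuccessors U R D t := by
        refine ZFSet.mem_sep.2 ⟨hβω, hti β hβr hβt, ?_, hlarge⟩
        refine (hT.rel_of_initial ht'U (fun x hx => ZFSet.mem_union.2 (.inl hx)) ?_).2
        intro γ hγ hγt
        exact hti γ (ht'r hγ) hγt
      have hAM : A ⊆ M := hr.subset_of_notMem hκ hω hA hM fun h =>
        hβt (htA β hβr ((hr.model hA).2.1.fst_snd_mem hκ hω h).2)
      -- The ordinals below `β` that occur in `r` are in `M`, for otherwise `β` would be in a model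
      -- whose ordinal is smaller than `β`.
      have htM : t ⊆ M := fun γ hγ => by
        obtain ⟨hγω, N, hN⟩ := mem_work.1 (htr hγ)
        have hγβ := hti β hβr hβt γ hγ
        have hne : ZFSet.pair N γ ≠ ZFSet.pair M β := fun e =>
          ZFSet.mem_irrefl β ((ZFSet.pair_inj.1 e).2 ▸ hγβ)
        rcases hr.chain N γ M β hN hM hne with h | h
        · exact h.2
        · exact absurd ((hr.model hN).2.1.subset_of_countable hκ hω h.2
            (countable_of_mem_omegaOne hβω) hγβ) (hT.notMem_model hκ hr hN)
      have htM' : t ∈ M := hMe.mem_of_finite hκ (hMe.empty_mem hκ (hAM hDA)) htM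
        (hfin.subset fun x hx => htr hx)
      obtain ⟨X, hXM, hX⟩ := hMe.exists_mem₂ (p := fun t f x => ZFSet.pair t x ∈ f) htM'
        (hAM hDA) ⟨largeSuccessors U R D t,
          mem_H_of_subset (hT.omegaOne_mem_H hκ hI) fun y hy => (ZFSet.mem_sep.1 hy).1,
          ZFSet.mem_range.2 ⟨⟨t, htU⟩, rfl⟩⟩
      obtain ⟨t', ht'⟩ := ZFSet.mem_range.1 hX
      obtain ⟨e, rfl⟩ := ZFSet.pair_inj.1 ht'
      rw [e] at hXM
      exact hT.largeAbove_of_successors fun hXI =>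
        hβM (ZFSet.mem_sUnion.2 ⟨_, ZFSet.mem_inter.2 ⟨hXI, hXM⟩, hβX⟩)

/-- Two conditions `e` and `d` have the lower bound `e ∪ d` if `d` is in all models of `e` outside
a common part `s`, and `w(e)` precedes `w(e) ∪ w(d)`. -/
theorem IsIdealBasedTriple.amalgamate (hT : IsIdealBasedTriple U R I) (hκ : κ.IsRegular)
    (hI : I ∈ H κ) (he : IsCondition U I κ e) (hd : IsCondition U I κ d) (hsd : s ⊆ d)
    (hN : ∀ N γ, ZFSet.pair N γ ∈ e → ZFSet.pair N γ ∉ s → d ⊆ N)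
    (hR : ZFSet.pair (work e) (work e ∪ work d) ∈ R) :
    (idealForcing U R I κ hT).Le (e ∪ d) e ∧ (idealForcing U R I κ hT).Le (e ∪ d) d := by
  have hω := hT.aleph0_lt hI
  have hw : work (e ∪ d) = work e ∪ work d := ZFSet.ext fun x => by
    simp only [ZFSet.mem_union, mem_work]
    constructor
    · rintro ⟨hx, M, h | h⟩
      exacts [.inl ⟨hx, M, h⟩, .inr ⟨hx, M, h⟩]
    · rintro (⟨hx, M, h⟩ | ⟨hx, M, h⟩)
      exacts [⟨hx, M, .inl h⟩, ⟨hx, M, .inr h⟩]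
  have hcomp : ∀ N γ M β, ZFSet.pair N γ ∈ e → ZFSet.pair N γ ∉ d → ZFSet.pair M β ∈ d →
      M ∈ N ∧ β ∈ N := fun N γ M β h h' hM =>
    (he.model h).2.1.fst_snd_mem hκ hω (hN N γ h (fun hs => h' (hsd hs)) hM)
  have hed : IsCondition U I κ (e ∪ d) := by
    refine ⟨?_, fun x hx => ?_, hw ▸ hT.right_mem hR, fun M α N β hM hN' hne => ?_⟩
    · rw [ZFSet.coe_union]; exact he.finite.union hd.finite
    · exact (ZFSet.mem_union.1 hx).elim (he.mem_pair x) (hd.mem_pair x)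
    · by_cases h1 : ZFSet.pair M α ∈ d <;> by_cases h2 : ZFSet.pair N β ∈ d
      · exact hd.chain M α N β h1 h2 hne
      · exact .inl (hcomp N β M α ((ZFSet.mem_union.1 hN').resolve_right h2) h2 h1)
      · exact .inr (hcomp M α N β ((ZFSet.mem_union.1 hM).resolve_right h1) h1 h2)
      · exact he.chain M α N β ((ZFSet.mem_union.1 hM).resolve_right h1)
          ((ZFSet.mem_union.1 hN').resolve_right h2) hne
  refine ⟨ZFSet.mem_pairSep.2 ⟨_, mem_conditions.2 hed, _, mem_conditions.2 he, rfl,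
    fun x hx => ZFSet.mem_union.2 (.inl hx), hw ▸ hR⟩,
    ZFSet.mem_pairSep.2 ⟨_, mem_conditions.2 hed, _, mem_conditions.2 hd, rfl,
    fun x hx => ZFSet.mem_union.2 (.inr hx), ?_⟩⟩
  rw [hw]
  refine (hT.rel_of_initial (hT.right_mem hR) (fun x hx => ZFSet.mem_union.2 (.inr hx)) ?_).2
  intro γ hγ hγd β hβ
  obtain ⟨hγω, N, hNγ⟩ := mem_work.1 ((ZFSet.mem_union.1 hγ).resolve_right hγd)
  obtain ⟨hβω, M, hM⟩ := mem_work.1 hβ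
  exact (he.model hNγ).2.1.mem_of_notMem hκ hω hβω hγω
    (hcomp N γ M β hNγ (fun h => hγd (mem_work.2 ⟨hγω, N, h⟩)) hM).2
    (hT.notMem_model hκ he hNγ)

end Triple

/-! ### The filters -/

namespace Poset

variable {P : Poset.{u}} {p q b c s : ZFSet.{u}}

theorem mem_RO : b ∈ P.RO ↔ b ⊆ P.carrier ∧
    ∀ p ∈ P.carrier, p ∈ b ↔ ∀ q, P.Le q p → ∃ r, P.Le r q ∧ r ∈ b := by
  rw [RO, ZFSet.mem_sep, ZFSet.mem_powerset]

theorem mem_of_le (hs : s ∈ P.RO) (hp : p ∈ s) (h : P.Le q p) : q ∈ s := by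
  obtain ⟨hsP, hs⟩ := mem_RO.1 hs
  refine (hs q h.left_mem).2 fun r hr => ?_
  exact (hs p (hsP hp)).1 hp r (P.trans _ _ _ hr h)

theorem carrier_mem_RO : P.carrier ∈ P.RO :=
  mem_RO.2 ⟨fun _ h => h, fun _ hp => ⟨fun _ q hq => ⟨q, P.refl q hq.left_mem, hq.left_mem⟩,
    fun _ => hp⟩⟩

theorem inter_mem_RO (hb : b ∈ P.RO) (hc : c ∈ P.RO) : b ∩ c ∈ P.RO := by
  have hb' := (mem_RO.1 hb).2
  have hc' := (mem_RO.1 hc).2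
  refine mem_RO.2 ⟨fun x hx => (mem_RO.1 hb).1 (ZFSet.mem_inter.1 hx).1, fun p hp => ?_⟩
  constructor
  · intro h q hq
    obtain ⟨h1, h2⟩ := ZFSet.mem_inter.1 h
    exact ⟨q, P.refl q hq.left_mem,
      ZFSet.mem_inter.2 ⟨mem_of_le hb h1 hq, mem_of_le hc h2 hq⟩⟩
  · intro h
    refine ZFSet.mem_inter.2 ⟨(hb' p hp).2 fun q hq => ?_, (hc' p hp).2 fun q hq => ?_⟩
    all_goals obtain ⟨r, hr, hrbc⟩ := h q hq
    exacts [⟨r, hr, (ZFSet.mem_inter.1 hrbc).1⟩, ⟨r, hr, (ZFSet.mem_inter.1 hrbc).2⟩]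

end Poset

section Filter

variable {U R I : ZFSet.{u}} {κ : Cardinal.{u}} {t p q d s z D : ZFSet.{u}}

/-- The conditions in `D` that extend `s` by models containing `z` only. -/
noncomputable def extensions (U I : ZFSet.{u}) (κ : Cardinal.{u}) (D z s : ZFSet.{u}) :
    ZFSet.{u} :=
  ZFSet.sep (fun d => d ∈ D ∧ s ⊆ d ∧ ∀ N γ, ZFSet.pair N γ ∈ d → ZFSet.pair N γ ∉ s → z ∈ N)
    (conditions U I κ)

theorem mem_extensions : d ∈ extensions U I κ D z s ↔ IsCondition U I κ d ∧ d ∈ D ∧ s ⊆ d ∧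
    ∀ N γ, ZFSet.pair N γ ∈ d → ZFSet.pair N γ ∉ s → z ∈ N := by
  rw [extensions, ZFSet.mem_sep, mem_conditions]

/-- The set `D` of conditions is large above `s`, even if the models are required to contain an
arbitrary given set. -/
def Robust (U R I : ZFSet.{u}) (κ : Cardinal.{u}) (D s : ZFSet.{u}) : Prop :=
  ∀ z ∈ H κ, LargeAbove U R (extensions U I κ D z s) (work s)

theorem work_mono (h : p ⊆ q) : work p ⊆ work q := fun _ hx =>
  mem_work.2 ⟨(mem_work.1 hx).1, (mem_work.1 hx).2.imp fun _ hM => h hM⟩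

/-- If a witness of largeness is in all models of the condition `e` outside `s`, then one of its
elements can be amalgamated with `e`. -/
theorem IsWitness.exists_amalgam (hT : IsIdealBasedTriple U R I) (hκ : κ.IsRegular)
    (hI : I ∈ H κ) {e C S : ZFSet.{u}} (h : IsWitness U R (extensions U I κ D z s) (work s) C S)
    (he : IsCondition U I κ e) (hse : s ⊆ e)
    (hCS : ∀ N γ, ZFSet.pair N γ ∈ e → ZFSet.pair N γ ∉ s → C ⊆ N ∧ S ⊆ N) :
    ∃ d ∈ C, d ∈ extensions U I κ D z s ∧ (idealForcing U R I κ hT).Le (e ∪ d) e ∧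
      (idealForcing U R I κ hT).Le (e ∪ d) d := by
  have hω := hT.aleph0_lt hI
  obtain ⟨d, hdC, _, hR⟩ := h.exists_mem (work e) he.work_mem (work_mono hse)
      fun γ hγ hγs x hx => by
    obtain ⟨hγω, N, hN⟩ := mem_work.1 hγ
    have hNs : ZFSet.pair N γ ∉ s := fun hNs => hγs (mem_work.2 ⟨hγω, N, hNs⟩)
    exact (he.model hN).2.1.mem_of_notMem hκ hω (h.subset_omegaOne hx) hγω
      ((hCS N γ hN hNs).2 hx) (hT.notMem_model hκ he hN)
  obtain ⟨hd, _, hsd, _⟩ := mem_extensions.1 (h.subset hdC)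
  refine ⟨d, hdC, h.subset hdC, hT.amalgamate hκ hI he hd hsd (fun N γ hN hNs => ?_) hR⟩
  exact (he.model hN).2.1.subset_of_countable hκ hω ((hCS N γ hN hNs).1 hdC) hd.finite.countable

theorem IsWitness.pair_mem_H (hT : IsIdealBasedTriple U R I) (hκ : κ.IsRegular)
    (hI : I ∈ H κ) {C S : ZFSet.{u}} (h : IsWitness U R (extensions U I κ D z s) t C S) :
    ZFSet.pair C S ∈ H κ := by
  have hω := hT.aleph0_lt hI
  refine YForcing.pair_mem_H hκ (mem_H_of_countable hκ hω (fun d hd => ?_) h.countable)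
    (mem_H_of_subset (hT.omegaOne_mem_H hκ hI) h.subset_omegaOne)
  exact hT.condition_mem_H hκ hI (mem_extensions.1 (h.subset hd)).1

/-- Finitely many robust regular open sets have a common element. It is built by recursion: the
models of the condition in all but the first set can be required to contain a witness of the
largeness of the first set. -/
theorem Robust.exists_forall_mem (hT : IsIdealBasedTriple U R I) (hκ : κ.IsRegular)
    (hI : I ∈ H κ) (hs : IsCondition U I κ s) (l : List ZFSet.{u})
    (hl : ∀ b ∈ l, b ∈ (idealForcing U R I κ hT).RO ∧ Robust U R I κ b s) :
    ∀ z ∈ H κ, ∃ e, IsCondition U I κ e ∧ (∀ b ∈ l, e ∈ b) ∧ s ⊆ e ∧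
      ∀ N γ, ZFSet.pair N γ ∈ e → ZFSet.pair N γ ∉ s → z ∈ N := by
  have hω := hT.aleph0_lt hI
  induction l with
  | nil => exact fun z _ => ⟨s, hs, by simp, fun _ h => h, fun N γ h h' => absurd h h'⟩
  | cons b l ih =>
    intro z hz
    obtain ⟨hb, hbR⟩ := hl b (by simp)
    obtain ⟨C, S, hCS⟩ := hbR z hz
    obtain ⟨e, he, hel, hse, heN⟩ := ih (fun c hc => hl c (by simp [hc])) (ZFSet.pair z
      (ZFSet.pair C S)) (pair_mem_H hκ hz (hCS.pair_mem_H hT hκ hI))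
    have heN' : ∀ N γ, ZFSet.pair N γ ∈ e → ZFSet.pair N γ ∉ s → z ∈ N ∧ C ⊆ N ∧ S ⊆ N := by
      intro N γ hN hNs
      have hNe := (he.model hN).2.1
      obtain ⟨h1, h2⟩ := hNe.fst_snd_mem hκ hω (heN N γ hN hNs)
      obtain ⟨h3, h4⟩ := hNe.fst_snd_mem hκ hω h2
      exact ⟨h1, hNe.subset_of_countable hκ hω h3 hCS.countable,
        hNe.subset_of_countable hκ hω h4 hCS.countable'⟩
    obtain ⟨d, -, hd, h1, h2⟩ := hCS.exists_amalgam hT hκ hI he hse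
      fun N γ hN hNs => (heN' N γ hN hNs).2
    obtain ⟨-, hdb, -, hdN⟩ := mem_extensions.1 hd
    refine ⟨e ∪ d, mem_conditions.1 h1.left_mem, ?_, fun x hx => ZFSet.mem_union.2 (.inl (hse hx)),
      fun N γ hN hNs => ?_⟩
    · intro c hc
      rcases List.mem_cons.1 hc with rfl | hc'
      · exact Poset.mem_of_le hb hdb h2
      · exact Poset.mem_of_le (hl c hc).1 (hel c hc') h1
    · rcases ZFSet.mem_union.1 hN with h | h
      exacts [(heN' N γ h hNs).1, hdN N γ h hNs]

/-- The filter on the completion generated by the robust sets. -/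
noncomputable def robustFilter (U R I : ZFSet.{u}) (κ : Cardinal.{u})
    (hT : IsIdealBasedTriple U R I) (s : ZFSet.{u}) : ZFSet.{u} :=
  ZFSet.sep (fun b => ∃ l : List ZFSet.{u},
    (∀ c ∈ l, c ∈ (idealForcing U R I κ hT).RO ∧ Robust U R I κ c s) ∧
      ∀ x ∈ conditions U I κ, (∀ c ∈ l, x ∈ c) → x ∈ b) (idealForcing U R I κ hT).RO

theorem isFilterRO_robustFilter (hT : IsIdealBasedTriple U R I) (hκ : κ.IsRegular)
    (hI : I ∈ H κ) (hs : IsCondition U I κ s) :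
    (idealForcing U R I κ hT).IsFilterRO (robustFilter U R I κ hT s) where
  subset _ hb := (ZFSet.mem_sep.1 hb).1
  nonempty := ⟨conditions U I κ, ZFSet.mem_sep.2
    ⟨Poset.carrier_mem_RO (P := idealForcing U R I κ hT), [], by simp, fun x hx _ => hx⟩⟩
  empty_notMem h := by
    obtain ⟨l, hl, hx⟩ := (ZFSet.mem_sep.1 h).2
    obtain ⟨e, he, hel, -⟩ := Robust.exists_forall_mem hT hκ hI hs l hl ∅ (empty_mem_H hκ)
    exact ZFSet.notMem_empty e (hx e (mem_conditions.2 he) hel)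
  mem_of_subset b hb c hc hbc := by
    obtain ⟨l, hl, hx⟩ := (ZFSet.mem_sep.1 hb).2
    exact ZFSet.mem_sep.2 ⟨hc, l, hl, fun x h h' => hbc (hx x h h')⟩
  directed b hb c hc := by
    obtain ⟨hb, l, hl, hx⟩ := ZFSet.mem_sep.1 hb
    obtain ⟨hc, m, hm, hy⟩ := ZFSet.mem_sep.1 hc
    refine ⟨b ∩ c, ZFSet.mem_sep.2 ⟨Poset.inter_mem_RO hb hc, l ++ m, fun d hd => ?_,
      fun x h h' => ?_⟩, fun x h => (ZFSet.mem_inter.1 h).1, fun x h => (ZFSet.mem_inter.1 h).2⟩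
    · exact (List.mem_append.1 hd).elim (hl d) (hm d)
    · exact ZFSet.mem_inter.2 ⟨hx x h fun d hd => h' d (List.mem_append.2 (.inl hd)),
        hy x h fun d hd => h' d (List.mem_append.2 (.inr hd))⟩

theorem mem_robustFilter {hT : IsIdealBasedTriple U R I}
    (hD : D ∈ (idealForcing U R I κ hT).RO) (h : Robust U R I κ D s) :
    D ∈ robustFilter U R I κ hT s :=
  ZFSet.mem_sep.2 ⟨hD, [D], by simpa using ⟨hD, h⟩, by simp⟩

end Filter

/-! ### Y-master conditions -/

section Master

variable {U R I : ZFSet.{u}} {κ : Cardinal.{u}}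

open Classical in
/-- A code of a witness that `D` is large above `t`, if there is one. -/
noncomputable def witness (U R D t : ZFSet.{u}) : ZFSet.{u} :=
  if h : ∃ x C S, x = ZFSet.pair C S ∧ IsWitness U R D t C S then h.choose else ∅

theorem exists_witness_eq {D t : ZFSet.{u}} (h : LargeAbove U R D t) :
    ∃ C S, witness U R D t = ZFSet.pair C S ∧ IsWitness U R D t C S := by
  obtain ⟨C, S, hCS⟩ := h
  have h : ∃ x C S, x = ZFSet.pair C S ∧ IsWitness U R D t C S := ⟨_, C, S, rfl, hCS⟩
  rw [witness, dif_pos h]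
  exact h.choose_spec

open Classical in
/-- A set that shows that `D` is not robust over `s`, if there is one. -/
noncomputable def counterexample (U R I : ZFSet.{u}) (κ : Cardinal.{u}) (D s : ZFSet.{u}) :
    ZFSet.{u} :=
  if h : ∃ z ∈ H κ, ¬ LargeAbove U R (extensions U I κ D z s) (work s) then h.choose else ∅

theorem counterexample_mem_H (hκ : κ.IsRegular) (D s : ZFSet.{u}) :
    counterexample U R I κ D s ∈ H κ := by
  unfold counterexample
  split_ifs with h
  exacts [h.choose_spec.1, empty_mem_H hκ]

theorem robust_of_counterexample {D s : ZFSet.{u}} (h : LargeAbove U R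
    (extensions U I κ D (counterexample U R I κ D s) s) (work s)) : Robust U R I κ D s := by
  by_contra hcon
  have h' : ∃ z ∈ H κ, ¬ LargeAbove U R (extensions U I κ D z s) (work s) := by
    simpa only [Robust, not_forall, exists_prop] using hcon
  rw [counterexample, dif_pos h'] at h
  exact h'.choose_spec.2 h

/-- The closure properties of a countable set `N` that make it possible to find Y-master
conditions. -/
structure IsSuitable (U R I : ZFSet.{u}) (κ : Cardinal.{u}) (hT : IsIdealBasedTriple U R I)
    (N : ZFSet.{u}) : Prop where
  countable : (N : Set ZFSet.{u}).Countable
  elemSub : ElemSub (N ∩ H κ) (H κ)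
  map_mem : ∀ D ∈ N, ∀ z ∈ N, ∀ s ∈ N, largeSuccessorsMap U R (extensions U I κ D z s) ∈ N
  witness_mem : ∀ D ∈ N, ∀ z ∈ N, ∀ s ∈ N,
    witness U R (extensions U I κ D z s) (work s) ∈ H κ →
      witness U R (extensions U I κ D z s) (work s) ∈ N
  filter_mem : ∀ s ∈ N, robustFilter U R I κ hT s ∈ N
  counterexample_mem : ∀ D ∈ N, ∀ s ∈ N, counterexample U R I κ D s ∈ N

variable {N p q r D z α : ZFSet.{u}}

theorem idealForcing_le_iff {hT : IsIdealBasedTriple U R I} :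
    (idealForcing U R I κ hT).Le q p ↔ IsCondition U I κ q ∧ IsCondition U I κ p ∧ p ⊆ q ∧
      ZFSet.pair (work p) (work q) ∈ R := by
  constructor
  · intro h
    obtain ⟨a, ha, b, hb, e, h⟩ := ZFSet.mem_pairSep.1 h
    obtain ⟨rfl, rfl⟩ := ZFSet.pair_inj.1 e
    exact ⟨mem_conditions.1 ha, mem_conditions.1 hb, h⟩
  · rintro ⟨hq, hp, h⟩
    exact ZFSet.mem_pairSep.2 ⟨q, mem_conditions.2 hq, p, mem_conditions.2 hp, rfl, h⟩

/-- The restriction of a condition to one of its models is in the model. -/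
theorem IsSuitable.inter_mem {hT : IsIdealBasedTriple U R I} (hN : IsSuitable U R I κ hT N)
    (hκ : κ.IsRegular) (hr : IsCondition U I κ r) (h0 : z ∈ N ∩ H κ) :
    r ∩ (N ∩ H κ) ∈ N ∩ H κ :=
  hN.elemSub.mem_of_finite hκ (hN.elemSub.empty_mem hκ h0)
    (fun _ hx => (ZFSet.mem_inter.1 hx).2) (hr.finite.subset fun _ hx => (ZFSet.mem_inter.1 hx).1)

/-- If `D ∈ N` contains a condition `r` with model `N ∩ H κ`, then `D` is large above the
restriction of `r` to this model, even with models that contain a given element of `N ∩ H κ`. -/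
theorem IsSuitable.largeAbove {hT : IsIdealBasedTriple U R I} (hN : IsSuitable U R I κ hT N)
    (hκ : κ.IsRegular) (hI : I ∈ H κ) (hr : IsCondition U I κ r)
    (hα : ZFSet.pair (N ∩ H κ) α ∈ r) (hrD : r ∈ D) (hD : D ∈ N) (hz : z ∈ N ∩ H κ) :
    LargeAbove U R (extensions U I κ D z (r ∩ (N ∩ H κ))) (work (r ∩ (N ∩ H κ))) := by
  have hω := hT.aleph0_lt hI
  have hs := hN.inter_mem hκ hr hz
  have hmem : r ∈ extensions U I κ D z (r ∩ (N ∩ H κ)) := mem_extensions.2 ⟨hr, hrD,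
    fun x hx => (ZFSet.mem_inter.1 hx).1, fun M γ hM hMs =>
      hr.subset_of_notMem hκ hω hα hM (fun h => hMs (ZFSet.mem_inter.2 ⟨hM, h⟩)) hz⟩
  refine hT.largeAbove_of_mem hκ hI hr hmem hα (ZFSet.mem_inter.2
    ⟨hN.map_mem D hD z (ZFSet.mem_inter.1 hz).1 _ (ZFSet.mem_inter.1 hs).1,
      hT.largeSuccessorsMap_mem_H hκ hI⟩) _ ?_ ?_ ?_
  · exact work_mono fun x hx => (ZFSet.mem_inter.1 hx).1
  · rw [hT.work_inter hκ hI hr hα]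
    intro γ hγ hγN β hβ
    rw [ZFSet.mem_inter] at hβ hγN
    exact hN.elemSub.mem_of_notMem hκ hω (mem_work.1 hβ.1).1 (mem_work.1 hγ).1 hβ.2
      fun h => hγN ⟨hγ, h⟩
  · rw [hT.work_inter hκ hI hr hα]
    exact fun γ hγ hγN => ZFSet.mem_inter.2 ⟨hγ, hγN⟩

/-- A condition that has `N ∩ H κ` as one of its models is Y-master for `N`. -/
theorem IsSuitable.isYMaster {hT : IsIdealBasedTriple U R I} (hN : IsSuitable U R I κ hT N)
    (hκ : κ.IsRegular) (hI : I ∈ H κ) (hα : ZFSet.pair (N ∩ H κ) α ∈ q) (hz : z ∈ N ∩ H κ) :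
    (idealForcing U R I κ hT).IsYMaster N q := by
  have hω := hT.aleph0_lt hI
  have hNN : N ∩ H κ ⊆ N := fun x hx => (ZFSet.mem_inter.1 hx).1
  refine ⟨fun D hD hdense r hr => ?_, fun r hr => ?_⟩
  · obtain ⟨e, heD, her⟩ := hdense.2 r (Poset.Le.left_mem hr)
    obtain ⟨he, -, hre, -⟩ := idealForcing_le_iff.1 her
    have hαe := hre ((idealForcing_le_iff.1 hr).2.2.1 hα)
    have hs := hN.inter_mem hκ he hz
    have hz' := hN.elemSub.empty_mem hκ hz
    obtain ⟨C, S, hw, hCS⟩ := exists_witness_eq (hN.largeAbove hκ hI he hαe heD hD hz')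
    have hCSN : ZFSet.pair C S ∈ N ∩ H κ := by
      have hH := hCS.pair_mem_H hT hκ hI
      refine ZFSet.mem_inter.2 ⟨?_, hH⟩
      rw [← hw] at hH ⊢
      exact hN.witness_mem D hD _ (hNN hz') _ (hNN hs) hH
    obtain ⟨hC, hS⟩ := hN.elemSub.fst_snd_mem hκ hω hCSN
    have hC' := hN.elemSub.subset_of_countable hκ hω hC hCS.countable
    have hS' := hN.elemSub.subset_of_countable hκ hω hS hCS.countable'
    obtain ⟨d, hdC, hd, h1, h2⟩ := hCS.exists_amalgam hT hκ hI he
      (fun x hx => (ZFSet.mem_inter.1 hx).1) fun M γ hM hMs => by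
        have hNM := he.subset_of_notMem hκ hω hαe hM
          fun h => hMs (ZFSet.mem_inter.2 ⟨hM, h⟩)
        exact ⟨fun x hx => hNM (hC' hx), fun x hx => hNM (hS' hx)⟩
    exact ⟨d, (mem_extensions.1 hd).2.1, hNN (hC' hdC), _, h2,
      (idealForcing U R I κ hT).trans _ _ _ h1 her⟩
  · obtain ⟨hrc, -, hqr, -⟩ := idealForcing_le_iff.1 hr
    have hs := hN.inter_mem hκ hrc hz
    refine ⟨_, hN.filter_mem _ (hNN hs), isFilterRO_robustFilter hT hκ hI
      (hT.isCondition_inter hκ hI hrc (hqr hα)), fun D hDR hD hrD => mem_robustFilter hDR ?_⟩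
    refine robust_of_counterexample (hN.largeAbove hκ hI hrc (hqr hα) (hrD ?_) hD
      (ZFSet.mem_inter.2 ⟨hN.counterexample_mem D hD _ (hNN hs), counterexample_mem_H hκ _ _⟩))
    exact ZFSet.mem_sep.2 ⟨Poset.Le.left_mem hr, fun x hx =>
      ⟨x, (idealForcing U R I κ hT).refl x (Poset.Le.left_mem hx), hx⟩⟩

/-- The condition `p` is extended by the model `N ∩ H κ`, together with an ordinal outside the sets
in `I ∩ N` that may be added to `w(p)`. -/
theorem IsSuitable.exists_isYMaster {hT : IsIdealBasedTriple U R I} (hN : IsSuitable U R I κ hT N)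
    (hκ : κ.IsRegular) (hI : I ∈ H κ) (hp : IsCondition U I κ p) (hpN : p ∈ N) :
    ∃ q, (idealForcing U R I κ hT).Le q p ∧ (idealForcing U R I κ hT).IsYMaster N q := by
  have hω := hT.aleph0_lt hI
  have hpM : p ∈ N ∩ H κ := ZFSet.mem_inter.2 ⟨hpN, hT.condition_mem_H hκ hI hp⟩
  have hpM' := hN.elemSub.subset_of_countable hκ hω hpM hp.finite.countable
  have hMc : ((N ∩ H κ : ZFSet.{u}) : Set ZFSet.{u}).Countable :=
    hN.countable.mono fun x hx => (ZFSet.mem_inter.1 hx).1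
  obtain ⟨α, hα, hα'⟩ : ∃ α ∈ ZFSet.sep (fun β => ZFSet.pair (work p) (work p ∪ {β}) ∈ R) omegaOne,
      α ∉ ZFSet.sUnion (I ∩ (N ∩ H κ)) := by
    by_contra! hcon
    exact hT.not_covered _ hp.work_mem (I ∩ (N ∩ H κ)) (fun x hx => (ZFSet.mem_inter.1 hx).1)
      (hMc.mono fun x hx => (ZFSet.mem_inter.1 hx).2) fun x hx => hcon x hx
  obtain ⟨hαω, hαR⟩ := ZFSet.mem_sep.1 hα
  have hw : work (insert (ZFSet.pair (N ∩ H κ) α) p) = work p ∪ {α} := ZFSet.ext fun x => by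
    simp only [ZFSet.mem_union, ZFSet.mem_singleton, mem_work, ZFSet.mem_insert_iff,
      ZFSet.pair_inj]
    constructor
    · rintro ⟨hx, M, ⟨-, rfl⟩ | h⟩
      exacts [.inr rfl, .inl ⟨hx, M, h⟩]
    · rintro (⟨hx, M, h⟩ | rfl)
      exacts [⟨hx, M, .inr h⟩, ⟨hαω, _, .inl ⟨rfl, rfl⟩⟩]
  have hq : IsCondition U I κ (insert (ZFSet.pair (N ∩ H κ) α) p) := by
    refine ⟨?_, fun x hx => ?_, hw ▸ hT.right_mem hαR, fun M β M' β' h h' hne => ?_⟩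
    · rw [ZFSet.coe_insert]; exact hp.finite.insert _
    · rcases ZFSet.mem_insert_iff.1 hx with rfl | hx
      exacts [⟨_, α, rfl, hMc, hN.elemSub, hαω, hα'⟩, hp.mem_pair x hx]
    · rcases ZFSet.mem_insert_iff.1 h with e | h <;> rcases ZFSet.mem_insert_iff.1 h' with e' | h'
      · exact absurd (e.trans e'.symm) hne
      · rw [(ZFSet.pair_inj.1 e).1]
        exact .inr (hN.elemSub.fst_snd_mem hκ hω (hpM' h'))
      · rw [(ZFSet.pair_inj.1 e').1]
        exact .inl (hN.elemSub.fst_snd_mem hκ hω (hpM' h))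
      · exact hp.chain M β M' β' h h' hne
  exact ⟨_, idealForcing_le_iff.2 ⟨hq, hp, fun x hx => ZFSet.mem_insert_of_mem _ hx, hw ▸ hαR⟩,
    hN.isYMaster hκ hI (ZFSet.mem_insert _ _) hpM⟩

/-- The functions under which a countable set has to be closed in order to be suitable: the Skolem
functions of `H κ`, and four functions of the first three members of a sequence. -/
noncomputable def closureFunction (U R I : ZFSet.{u}) (κ : Cardinal.{u})
    (hT : IsIdealBasedTriple U R I) :
    (Σ n, setLanguage.BoundedFormula Empty (n + 1)) ⊕ Fin 4 → List ZFSet.{u} → ZFSet.{u}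
  | .inl φ, l => skolem (H κ) φ l
  | .inr 0, l => largeSuccessorsMap U R (extensions U I κ (l.getD 0 ∅) (l.getD 1 ∅) (l.getD 2 ∅))
  | .inr 1, l => witness U R (extensions U I κ (l.getD 0 ∅) (l.getD 1 ∅) (l.getD 2 ∅))
      (work (l.getD 2 ∅))
  | .inr 2, l => robustFilter U R I κ hT (l.getD 0 ∅)
  | .inr 3, l => counterexample U R I κ (l.getD 0 ∅) (l.getD 1 ∅)

theorem isSuitable_of_closed (hT : IsIdealBasedTriple U R I) (hκ : κ.IsRegular) (hI : I ∈ H κ)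
    {K : ZFSet.{u}} (hHK : H κ ⊆ K) (hFK : ∀ F, F ⊆ (idealForcing U R I κ hT).RO → F ∈ K)
    (hNc : (N : Set ZFSet.{u}).Countable)
    (hcl : ∀ i l, (∀ x ∈ l, x ∈ N) → closureFunction U R I κ hT i l ∈ K →
      closureFunction U R I κ hT i l ∈ N) : IsSuitable U R I κ hT N where
  countable := hNc
  elemSub := by
    refine elemSub_of_skolem (fun x hx => (ZFSet.mem_inter.1 hx).2) fun φ l hl h => ?_
    exact ZFSet.mem_inter.2
      ⟨hcl (.inl φ) l (fun x hx => (ZFSet.mem_inter.1 (hl x hx)).1) (hHK h), h⟩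
  map_mem D hD z hz s hs := hcl (.inr 0) [D, z, s] (by simp [hD, hz, hs])
    (hHK (hT.largeSuccessorsMap_mem_H hκ hI))
  witness_mem D hD z hz s hs h := hcl (.inr 1) [D, z, s] (by simp [hD, hz, hs]) (hHK h)
  filter_mem s hs := hcl (.inr 2) [s] (by simp [hs])
    (hFK _ fun x (hx : x ∈ robustFilter U R I κ hT s) => (ZFSet.mem_sep.1 hx).1)
  counterexample_mem D hD s hs := hcl (.inr 3) [D, s] (by simp [hD, hs])
    (hHK (counterexample_mem_H hκ _ _))

theorem idealForcing_yProper (hT : IsIdealBasedTriple U R I) (hκ : κ.IsRegular) (hI : I ∈ H κ) :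
    (idealForcing U R I κ hT).YProper := by
  let P := idealForcing U R I κ hT
  -- A limit level of the cumulative hierarchy that contains `H κ`, the subsets of the forcing and
  -- the filters on its completion; limit levels are closed under pairing.
  let o : Ordinal.{u} := max (max P.carrier.rank P.RO.rank) (H κ).rank
  have hlim : Order.IsSuccLimit (o + Ordinal.omega0) :=
    Ordinal.isSuccLimit_add o Ordinal.isSuccLimit_omega0
  have ho : o < o + Ordinal.omega0 := lt_add_of_pos_right o Ordinal.omega0_pos
  have hmem : ∀ x : ZFSet.{u}, x.rank ≤ o →
      ∀ y, y ⊆ x → y ∈ ZFSet.vonNeumann (o + Ordinal.omega0) :=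
    fun x hx y hy => ZFSet.mem_vonNeumann.2 (((ZFSet.rank_mono hy).trans hx).trans_lt ho)
  have htr := ZFSet.isTransitive_vonNeumann (o + Ordinal.omega0)
  have hC : P.carrier.rank ≤ o := (le_max_left _ _).trans (le_max_left _ _)
  have hF : P.RO.rank ≤ o := (le_max_right _ _).trans (le_max_left _ _)
  have hH : (H κ).rank ≤ o := le_max_right _ _
  refine P.yProper_of_closed (closureFunction U R I κ hT) (ZFSet.vonNeumann (o + Ordinal.omega0))
    (hmem _ hC ∅ (ZFSet.empty_subset _)) ?_ ?_ (hmem _ hC) ?_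
  · intro x hx y hy
    rw [ZFSet.mem_vonNeumann] at hx hy ⊢
    simp only [ZFSet.pair, ZFSet.rank_insert, ZFSet.rank_singleton, max_lt_iff]
    refine ⟨hlim.succ_lt (hlim.succ_lt hx),
      hlim.succ_lt (max_lt (hlim.succ_lt hx) (hlim.succ_lt hy))⟩
  · exact fun x hx => htr.subset_of_mem (hmem _ hC _ fun _ h => h) hx
  · intro N hNK hNc hcl p hp hpN
    exact (isSuitable_of_closed hT hκ hI
      (fun x hx => htr.subset_of_mem (hmem _ hH _ fun _ h => h) hx) (hmem _ hF) hNc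
      hcl).exists_isYMaster hκ hI (mem_conditions.1 hp) hpN

end Master

end YForcing

theorem mainTheorem9 (P : YForcing.Poset.{u}) (hP : YForcing.IsIdealBased P) : P.YProper := by
  obtain ⟨U, R, I, κ, hT, hκ, hI, rfl⟩ := hP
  exact YForcing.idealForcing_yProper hT hκ hI
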